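/- **Setting.** Let $S,A$ be finite nonempty state and action sets and $R\subset[0,1]$ a finite set of rewards. For each $(s,a)\in S\times A$ let $p_{s,a}$ be a probability distribution on $S$ and $\nu_{s,a}$ a probability distribution on $R$, and let $\gamma\in(0,1)$. For $\delta>0$ let $\mathcal P_{s,a}(\delta)=\{p: D_{\mathrm{KL}}(p\|p_{s,a})\le\delta\}$ and $\mathcal R_{s,a}(\delta)=\{\nu: D_{\mathrm{KL}}(\nu\|\nu_{s,a})\le\delta\}$. Let $v^*\in\mathbb R^S$ be the unique solution of the distributionally robust (DR) Bellman equation $$v^*(s)=\max_{a\in A}\ \inf_{p\in\mathcal P_{s,a}(\delta),\,\nu\in\mathcal R_{s,a}(\delta)}\bigl\{E_{r\sim\nu}[r]+\gamma E_{s'\sim p}[v^*(s')]\bigr\},$$ and let $q^*(s,a)=\inf_{p\in\mathcal P_{s,a}(\delta),\,\nu\in\mathcal R_{s,a}(\delta)}\{E_{r\sim\nu}[r]+\gamma E_{s'\sim p}[v^*(s')]\}$ be the optimal DR $q$-function. Put $$p_\wedge=\min_{s,a}\Bigl[\min_{r:\,\nu_{s,a}(r)>0}\nu_{s,a}(r)\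 \wedge\ \min_{s':\,p_{s,a}(s')>0}p_{s,a}(s')\Bigr],\qquad d=|S||A|\max(|S|,|R|).$$ **Algorithm (DR Q-learning with $k_0$ iterations and batch size $n_0$).** Set $q_1\equiv0$. For $k=1,\dots,k_0$, draw for every $(s,a)$ fresh independent samples $r_1,\dots,r_{n_0}\sim\nu_{s,a}$ and $s'_1,\dots,s'_{n_0}\sim p_{s,a}$, with empirical measures $\nu_{s,a,n_0}$ and $p_{s,a,n_0}$ (all samples, over all $k$ and all $(s,a)$, being independent), and set $q_{k+1}=(1-\lambda_k)q_k+\lambda_k\mathbf T_{k+1}(q_k)$ with $\lambda_k=1/(1+(1-\gamma)k)$, where $$\mathbf T_{k+1}(q)(s,a)=\sup_{\alpha\ge0}\bigl\{-\alpha\log E_{r\sim\nu_{s,a,n_0}}[e^{-r/\alpha}]-\alpha\delta\bigr\}+\gamma\sup_{\beta\ge0}\bigl\{-\beta\log E_{s'\sim p_{s,a,n_0}}[e^{-\max_b q(s',b)/\beta}]-\beta\delta\bigr\},$$ the expressions at $\alpha=0$ and $\beta=0$ being the limits as $\alpha\downarrow0$ and $\beta\downarrow0$. The output is $q_{k_0+1}$.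 **Statement.** There are absolute constants $c_1,c_2>0$ such that, for every such $S,A,R,p,\nu,\gamma$, every $\delta$ with $0<\delta<-\log(1-\tfrac1{48}p_\wedge)$, every $\epsilon>0$ and every $\eta\in(0,1)$, DR Q-learning run with $$k_0=\left\lceil \frac{c_1}{(1-\gamma)^3\epsilon}\log^3\!\Bigl(\frac{4d}{(1-\gamma)\eta\epsilon}\Bigr)\right\rceil,\qquad n_0=\left\lceil \frac{c_2\log^2(4dk_0/\eta)}{p_\wedge^3(1-\gamma)^2\epsilon}\right\rceil$$ satisfies $\|q_{k_0+1}-q^*\|_\infty\le\epsilon$ with probability at least $1-\eta$. (If the expression for $k_0$ is not positive, then $k_0=0$ and the output is $q_1=0$.) -/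

import Mathlib

open MeasureTheory ProbabilityTheory

noncomputable section

/-- A finite discounted Markov decision process with random rewards: a finite set `R` of
nonnegative rewards, reward laws `ν s a` on `R`, transition laws `p s a` on the state space `S`,
and a discount factor `γ ∈ (0,1)`. -/
structure RewardMDP (S A : Type*) where
  R : Finset ℝ
  R_nonneg : ∀ r ∈ R, 0 ≤ r
  p : S → A → PMF S
  ν : S → A → PMF R
  γ : ℝ
  γ_pos : 0 < γ
  γ_lt_one : γ < 1

/-- Expectation of `f` under the (real) weights `w` on a finite type. -/
def expec {Y : Type*} [Fintype Y] (w : Y → ℝ) (f : Y → ℝ) : ℝ := ∑ y, w y * f y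

/-- The point masses of a probability mass function, as real numbers. -/
def massOf {Y : Type*} (μ : PMF Y) (y : Y) : ℝ := (μ y).toReal

/-- The empirical measure (as weights) of the samples `x 0, …, x (n-1)`. -/
def empirical {Y : Type*} {n : ℕ} (x : Fin n → Y) (y : Y) : ℝ :=
  (Nat.card {i : Fin n // x i = y} : ℝ) / (n : ℝ)

/-- The KL ball of radius `δ` around `μ`: laws `μ'` with `D_KL(μ' ‖ μ) ≤ δ`. -/
def klBall {Y : Type*} [MeasurableSpace Y] (μ : PMF Y) (δ : ℝ) : Set (PMF Y) :=
  {μ' | InformationTheory.klDiv μ'.toMeasure μ.toMeasure ≤ ENNReal.ofReal δ}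

/-- The KL dual functional `α ↦ -α log w[exp(-u/α)] - α δ`, whose value at `α = 0` is its limit
as `α ↓ 0`, the essential infimum of `u`. -/
def klDual {Y : Type*} [Fintype Y] (w u : Y → ℝ) (δ α : ℝ) : ℝ :=
  if α = 0 then ⨅ y : {y : Y // 0 < w y}, u y
  else -α * Real.log (expec w (fun y => Real.exp (-u y / α))) - α * δ

/-- `sup_{α ≥ 0}` of the KL dual functional. -/
def klDualSup {Y : Type*} [Fintype Y] (w u : Y → ℝ) (δ : ℝ) : ℝ :=
  ⨆ α : {α : ℝ // 0 ≤ α}, klDual w u δ α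

/-- The value function `v(q)(s) = max_b q(s,b)`. -/
def valueOf {S A : Type*} [Fintype A] [Nonempty A] (q : S → A → ℝ) (s : S) : ℝ :=
  Finset.univ.sup' Finset.univ_nonempty (fun b => q s b)

theorem massOf_sum {Y : Type*} [Fintype Y] (μ : PMF Y) : ∑ y, massOf μ y = 1 := by
  unfold massOf
  rw [← ENNReal.toReal_sum (fun y _ => μ.apply_ne_top y), ← tsum_fintype (L := .unconditional _),
    μ.tsum_coe, ENNReal.toReal_one]

theorem abs_expec_le {Y : Type*} [Fintype Y] (μ : PMF Y) (f : Y → ℝ) :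
    |expec (massOf μ) f| ≤ ‖f‖ := by
  calc |expec (massOf μ) f| ≤ ∑ y, |massOf μ y * f y| := Finset.abs_sum_le_sum_abs _ _
    _ ≤ ∑ y, massOf μ y * ‖f‖ := by
        refine Finset.sum_le_sum fun y _ => ?_
        have h0 : 0 ≤ massOf μ y := ENNReal.toReal_nonneg
        rw [abs_mul, abs_of_nonneg h0]
        exact mul_le_mul_of_nonneg_left (norm_le_pi_norm f y) h0
    _ = ‖f‖ := by rw [← Finset.sum_mul, massOf_sum, one_mul]

theorem self_mem_klBall {Y : Type*} [MeasurableSpace Y] (μ : PMF Y) (δ : ℝ) :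
    μ ∈ klBall μ δ := by
  simp [klBall, InformationTheory.klDiv_self]

namespace RewardMDP

variable {S A : Type*} [Fintype S] [MeasurableSpace S] (M : RewardMDP S A)

/-- The pairs `(p, ν)` in the product of the two KL balls around `p_{s,a}` and `ν_{s,a}`. -/
def Adversary (δ : ℝ) (s : S) (a : A) : Type _ :=
  klBall (M.p s a) δ × klBall (M.ν s a) δ

/-- `inf { E_ν[r] + γ E_p[v] }` over `p` and `ν` in the KL balls around `p_{s,a}`, `ν_{s,a}`. -/
def robustBackup (δ : ℝ) (v : S → ℝ) (s : S) (a : A) : ℝ :=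
  ⨅ x : M.Adversary δ s a,
    (expec (massOf x.2.1) (fun r : M.R => (r : ℝ)) + M.γ * expec (massOf x.1.1) v)

/-- The distributionally robust Bellman operator for value functions. -/
def bellman [Fintype A] [Nonempty A] (δ : ℝ) (v : S → ℝ) (s : S) : ℝ :=
  Finset.univ.sup' Finset.univ_nonempty (fun a => M.robustBackup δ v s a)

instance (δ : ℝ) (s : S) (a : A) : Nonempty (M.Adversary δ s a) :=
  ⟨(⟨_, self_mem_klBall _ δ⟩, ⟨_, self_mem_klBall _ δ⟩)⟩

theorem robustBackup_le (δ : ℝ) (v w : S → ℝ) (s : S) (a : A) :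
    M.robustBackup δ v s a ≤ M.robustBackup δ w s a + M.γ * ‖v - w‖ := by
  have hγ := M.γ_pos
  unfold robustBackup
  rw [← sub_le_iff_le_add]
  refine le_ciInf fun x => ?_
  rw [sub_le_iff_le_add]
  refine (ciInf_le ?_ x).trans ?_
  · refine ⟨-‖(fun r : M.R => (r : ℝ))‖ - M.γ * ‖v‖, ?_⟩
    rintro _ ⟨y, rfl⟩
    have h1 := (abs_le.1 (abs_expec_le y.2.1 (fun r : M.R => (r : ℝ)))).1
    have h2 := mul_le_mul_of_nonneg_left (abs_le.1 (abs_expec_le y.1.1 v)).1 hγ.le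
    simp only
    linarith
  · have h := (abs_le.1 (abs_expec_le x.1.1 (v - w))).2
    have h' : expec (massOf x.1.1) (v - w)
        = expec (massOf x.1.1) v - expec (massOf x.1.1) w := by
      simp [expec, mul_sub, Finset.sum_sub_distrib]
    rw [h'] at h
    have h2 := mul_le_mul_of_nonneg_left h hγ.le
    linarith

variable [Fintype A] [Nonempty A]

theorem bellman_le (δ : ℝ) (v w : S → ℝ) (s : S) :
    M.bellman δ v s ≤ M.bellman δ w s + M.γ * ‖v - w‖ := by
  unfold bellman
  refine Finset.sup'_le _ _ fun a ha => (M.robustBackup_le δ v w s a).trans ?_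
  gcongr
  exact Finset.le_sup' (fun a => M.robustBackup δ w s a) ha

/-- The robust Bellman operator is a `γ`-contraction in the sup norm. -/
theorem bellman_contracting (δ : ℝ) :
    ContractingWith ⟨M.γ, M.γ_pos.le⟩ (M.bellman δ) := by
  refine ⟨M.γ_lt_one, LipschitzWith.of_dist_le_mul fun v w => ?_⟩
  change dist _ _ ≤ M.γ * dist v w
  rw [dist_eq_norm, dist_eq_norm]
  refine (pi_norm_le_iff_of_nonneg (mul_nonneg M.γ_pos.le (norm_nonneg _))).2 fun s => ?_
  rw [Pi.sub_apply, Real.norm_eq_abs, abs_le]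
  have h1 := M.bellman_le δ v w s
  have h2 := M.bellman_le δ w v s
  rw [norm_sub_rev] at h2
  constructor <;> linarith

/-- The optimal robust value function: the unique solution of `v = bellman v`. -/
def vStar (δ : ℝ) : S → ℝ :=
  ContractingWith.fixedPoint (M.bellman δ) (M.bellman_contracting δ)

theorem vStar_eq_bellman (δ : ℝ) : M.vStar δ = M.bellman δ (M.vStar δ) :=
  (M.bellman_contracting δ).fixedPoint_isFixedPt.symm

theorem eq_vStar (δ : ℝ) (v : S → ℝ) (hv : v = M.bellman δ v) : v = M.vStar δ :=
  (M.bellman_contracting δ).fixedPoint_unique hv.symm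

/-- The optimal robust `q`-function. -/
def qStar (δ : ℝ) : S → A → ℝ := M.robustBackup δ (M.vStar δ)

/-- The empirical robust Bellman operator in dual form, built from `n` samples
`x s a i = (reward, next state)` at every state-action pair. -/
def empBellman (δ : ℝ) {n : ℕ} (x : S → A → Fin n → M.R × S) (q : S → A → ℝ)
    (s : S) (a : A) : ℝ :=
  klDualSup (empirical fun i => (x s a i).1) (fun r : M.R => (r : ℝ)) δ
    + M.γ * klDualSup (empirical fun i => (x s a i).2) (valueOf q) δ

/-- The stepsize `λ_k = 1 / (1 + (1 - γ) k)`. -/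
def stepsize (k : ℕ) : ℝ := 1 / (1 + (1 - M.γ) * (k : ℝ))

/-- Distributionally robust Q-learning with batch size `n`: `drQ δ n x k` is the iterate
`q_{k+1}`, obtained from `q_1 = 0` after `k` iterations, where iteration `k` uses the samples
`x k s a i`, `i < n`, and performs `q_{k+1} = (1 - λ_k) q_k + λ_k T_{k+1}(q_k)`. -/
def drQ (δ : ℝ) (n : ℕ) (x : ℕ → S → A → ℕ → M.R × S) : ℕ → S → A → ℝ
  | 0 => fun _ _ => 0
  | k + 1 => fun s a =>
      (1 - M.stepsize (k + 1)) * drQ δ n x k s a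
        + M.stepsize (k + 1)
          * M.empBellman δ (fun s a (i : Fin n) => x (k + 1) s a i) (drQ δ n x k) s a

/-- Output of a simulator: the `X k s a i = (reward, next state)` are mutually independent, and
each consists of independent draws from `ν_{s,a}` and `p_{s,a}`. -/
structure IsSimulator {Ω : Type*} [MeasurableSpace Ω] (P : Measure Ω)
    (X : ℕ → S → A → ℕ → Ω → M.R × S) : Prop where
  measurable : ∀ k s a i, Measurable (X k s a i)
  law : ∀ k s a i, P.map (X k s a i) = (M.ν s a).toMeasure.prod (M.p s a).toMeasure
  indep : iIndepFun (fun j : ℕ × S × A × ℕ => X j.1 j.2.1 j.2.2.1 j.2.2.2) P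

/-- The minimal support probability `p_∧`. -/
def pMin : ℝ :=
  ⨅ x : S × A, min (⨅ r : (M.ν x.1 x.2).support, massOf (M.ν x.1 x.2) r)
    (⨅ s' : (M.p x.1 x.2).support, massOf (M.p x.1 x.2) s')

/-- `d = |S| |A| max(|S|, |R|)`. -/
def dimConst : ℝ :=
  (Fintype.card S : ℝ) * (Fintype.card A : ℝ) * max (Fintype.card S : ℝ) (M.R.card : ℝ)

/-- The number of iterations
`k₀ = ⌈c₁ (1-γ)⁻³ ε⁻¹ log³(4d / ((1-γ) η ε))⌉`. -/
def numIter (c₁ ε η : ℝ) : ℕ :=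
  ⌈c₁ * (1 / ((1 - M.γ) ^ 3 * ε))
    * Real.log (4 * M.dimConst / ((1 - M.γ) * η * ε)) ^ 3⌉₊

/-- The batch size `n₀ = ⌈c₂ log²(4 d k₀ / η) / (p_∧³ (1-γ)² ε)⌉`. -/
def batchSize (c₂ ε η : ℝ) (k₀ : ℕ) : ℕ :=
  ⌈c₂ * (Real.log (4 * M.dimConst * (k₀ : ℝ) / η) ^ 2
    / (M.pMin ^ 3 * (1 - M.γ) ^ 2 * ε))⌉₊

end RewardMDP

end

/-! ### The KL dual functional -/

section KLDual

open InformationTheory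

variable {Y : Type*} [Fintype Y]

/-! The iterates are compared with the deterministic function `qStar`. For every sample the
empirical robust operator T is a γ-contraction, so `drQ - qStar` is the stepsize average of the
noise T(q*) - q* plus a remainder. With c = 1 - γ, the relation λ_k (1 - c λ_{k+1}) = λ_{k+1} bounds
that remainder by λ_k times the initial error plus the sum of the earlier noise averages
(`abs_drQ_sub_le`). Since q* is fixed, the noise in different iterations comes from independent
batches, and no martingale argument is needed.

A batch size of order 1/ε rather than 1/ε² suffices because the error of an empirical dual value
splits in two (`exists_klDualSup_expansion`). The part linear in the empirical measure is centred
and is averaged over iterations, which gives variance of order λ_k / n (`hoeffding_empirical`,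
`sum_sq_stepWeight_le`). The rest is quadratic in the relative deviation t of the empirical measure,
hence of order 1/n up to logarithms and powers of p_∧, and is simply bounded.

The constants in the expansion must not degenerate as δ → 0. When 47δ ≤ p_∧, a worst-case law is an
exponential tilt whose density ρ lies in [2/3, 4/3] on the support (it is the reference law itself
if u is constant there). Inserting the optimal multiplier for w into the dual problem for v gives a
lower bound. Weak duality with a correction of ρ that is feasible for v (`exists_perturbed_density`)
gives the upper bound. The same tilt yields strong duality, which identifies q* with the fixed point
of the dual operator (`robustBackup_eq_klDualSup`).

A union bound over iterations, state-action pairs and atoms, together with the arithmetic of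
`total_error_le`, finishes the proof. -/

theorem sum_weight_le {w a b : Y → ℝ} (hw : ∀ y, 0 ≤ w y) (h : ∀ y, 0 < w y → a y ≤ b y) :
    ∑ y, w y * a y ≤ ∑ y, w y * b y := by
  refine Finset.sum_le_sum fun y _ => ?_
  rcases (hw y).eq_or_lt with h0 | h0
  · simp [← h0]
  · exact mul_le_mul_of_nonneg_left (h y h0) h0.le

theorem sum_weight_le_const {w a : Y → ℝ} {c : ℝ} (hw : ∀ y, 0 ≤ w y) (hw1 : ∑ y, w y = 1)
    (h : ∀ y, 0 < w y → a y ≤ c) : ∑ y, w y * a y ≤ c := by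
  refine (sum_weight_le hw h).trans_eq ?_
  rw [← Finset.sum_mul, hw1, one_mul]

theorem const_le_sum_weight {w a : Y → ℝ} {c : ℝ} (hw : ∀ y, 0 ≤ w y) (hw1 : ∑ y, w y = 1)
    (h : ∀ y, 0 < w y → c ≤ a y) : c ≤ ∑ y, w y * a y := by
  refine le_of_eq_of_le ?_ (sum_weight_le hw h)
  rw [← Finset.sum_mul, hw1, one_mul]

theorem exists_weight_pos {w : Y → ℝ} (hw1 : ∑ y, w y = 1) : ∃ y, 0 < w y := by
  by_contra! h
  have := Finset.sum_nonpos (s := Finset.univ) fun y _ => h y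
  linarith

theorem sum_weight_exp_pos {w : Y → ℝ} (hw : ∀ y, 0 ≤ w y) (hw1 : ∑ y, w y = 1) (f : Y → ℝ) :
    0 < ∑ y, w y * Real.exp (f y) := by
  obtain ⟨y, hy⟩ := exists_weight_pos hw1
  exact Finset.sum_pos' (fun y _ => mul_nonneg (hw y) (Real.exp_pos _).le)
    ⟨y, Finset.mem_univ y, mul_pos hy (Real.exp_pos _)⟩

/-- Weak duality: every density of relative entropy at most `δ` bounds the KL dual functional. -/
theorem klDual_le_of_density {w r u : Y → ℝ} {δ α : ℝ} (hw : ∀ y, 0 ≤ w y) (hw1 : ∑ y, w y = 1)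
    (hr : ∀ y, 0 < w y → 0 ≤ r y) (hr1 : ∑ y, w y * r y = 1)
    (hD : ∑ y, w y * (r y * Real.log (r y)) ≤ δ) (hα : 0 ≤ α) :
    klDual w u δ α ≤ ∑ y, w y * r y * u y := by
  unfold klDual
  have hwr : ∀ y, 0 ≤ w y * r y := fun y => by
    rcases (hw y).eq_or_lt with h0 | h0
    · simp [← h0]
    · exact mul_nonneg h0.le (hr y h0)
  split_ifs with h0
  · refine const_le_sum_weight hwr hr1 fun y hy => ?_
    have hy' : 0 < w y := (hw y).lt_of_ne fun h => by simp [← h] at hy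
    exact ciInf_le (Set.finite_range _).bddBelow (⟨y, hy'⟩ : {y : Y // 0 < w y})
  · have hα' : 0 < α := lt_of_le_of_ne hα (Ne.symm h0)
    unfold expec
    have hZ := sum_weight_exp_pos hw hw1 (fun y => -u y / α)
    set Z := ∑ y, w y * Real.exp (-u y / α) with hZdef
    -- Gibbs' inequality in pointwise form: log a ≥ 1 - 1/a at a = r Z / exp(-u/α), weighted by w r.
    -- Summing over y makes the left side vanish.
    have key : ∀ y, w y * r y - w y * Real.exp (-u y / α) / Z
        ≤ w y * (r y * Real.log (r y)) + w y * r y * (Real.log Z + u y / α) := by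
      intro y
      rcases (hw y).eq_or_lt with h | h
      · simp [← h]
      rcases (hr y h).eq_or_lt with h' | h'
      · simp only [← h', mul_zero, zero_mul, add_zero, zero_sub]
        have : 0 ≤ w y * Real.exp (-u y / α) / Z := by positivity
        linarith
      · have h1 : 0 < r y * Z / Real.exp (-u y / α) := by positivity
        have h2 := Real.one_sub_inv_le_log_of_pos h1
        rw [Real.log_div (by positivity) (by positivity), Real.log_mul h'.ne' hZ.ne',
          Real.log_exp, inv_div] at h2
        have h3 := mul_le_mul_of_nonneg_left h2 (hwr y)
        have h4 : w y * r y * (1 - Real.exp (-u y / α) / (r y * Z))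
            = w y * r y - w y * Real.exp (-u y / α) / Z := by
          field_simp
        rw [h4] at h3
        refine h3.trans_eq ?_
        ring
    have hsum := Finset.sum_le_sum fun y (_ : y ∈ Finset.univ) => key y
    have e1 : ∑ y, (w y * r y - w y * Real.exp (-u y / α) / Z) = 0 := by
      rw [Finset.sum_sub_distrib, hr1, ← Finset.sum_div, ← hZdef, div_self hZ.ne', sub_self]
    have e2 : ∑ y, (w y * (r y * Real.log (r y)) + w y * r y * (Real.log Z + u y / α))
        = ∑ y, w y * (r y * Real.log (r y)) + Real.log Z + (∑ y, w y * r y * u y) / α := by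
      rw [Finset.sum_add_distrib, add_assoc]
      congr 1
      simp only [mul_add, Finset.sum_add_distrib]
      rw [← Finset.sum_mul, hr1, one_mul, Finset.sum_div]
      congr 1
      exact Finset.sum_congr rfl fun y _ => by ring
    rw [e1, e2] at hsum
    have h5 : 0 ≤ δ + Real.log Z + (∑ y, w y * r y * u y) / α := by linarith
    have h6 := mul_nonneg hα'.le h5
    have h7 : α * (δ + Real.log Z + (∑ y, w y * r y * u y) / α)
        = α * δ + α * Real.log Z + ∑ y, w y * r y * u y := by
      field_simp
    linarith

theorem klDual_le_expec {w u : Y → ℝ} {δ α : ℝ} (hw : ∀ y, 0 ≤ w y) (hw1 : ∑ y, w y = 1)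
    (hδ : 0 ≤ δ) (hα : 0 ≤ α) : klDual w u δ α ≤ ∑ y, w y * u y := by
  simpa using klDual_le_of_density (r := fun _ => 1) (u := u) hw hw1 (by simp) (by simpa)
    (by simpa) hα

theorem klDual_bddAbove {w : Y → ℝ} (u : Y → ℝ) {δ : ℝ} (hw : ∀ y, 0 ≤ w y) (hw1 : ∑ y, w y = 1)
    (hδ : 0 ≤ δ) : BddAbove (Set.range fun α : {α : ℝ // 0 ≤ α} => klDual w u δ α) :=
  ⟨_, by rintro _ ⟨α, rfl⟩; exact klDual_le_expec hw hw1 hδ α.2⟩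

instance : Nonempty {α : ℝ // 0 ≤ α} := ⟨⟨0, le_rfl⟩⟩

theorem klDualSup_le_of_density {w r u : Y → ℝ} {δ : ℝ} (hw : ∀ y, 0 ≤ w y)
    (hw1 : ∑ y, w y = 1) (hr : ∀ y, 0 < w y → 0 ≤ r y) (hr1 : ∑ y, w y * r y = 1)
    (hD : ∑ y, w y * (r y * Real.log (r y)) ≤ δ) :
    klDualSup w u δ ≤ ∑ y, w y * r y * u y :=
  ciSup_le fun α => klDual_le_of_density hw hw1 hr hr1 hD α.2

theorem klDualSup_le_const {w u : Y → ℝ} {δ c : ℝ} (hw : ∀ y, 0 ≤ w y) (hw1 : ∑ y, w y = 1)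
    (hδ : 0 ≤ δ) (hu : ∀ y, 0 < w y → u y ≤ c) : klDualSup w u δ ≤ c :=
  ciSup_le fun α => (klDual_le_expec hw hw1 hδ α.2).trans (sum_weight_le_const hw hw1 hu)

theorem const_le_klDualSup {w u : Y → ℝ} {δ c : ℝ} (hw : ∀ y, 0 ≤ w y) (hw1 : ∑ y, w y = 1)
    (hδ : 0 ≤ δ) (hu : ∀ y, 0 < w y → c ≤ u y) : c ≤ klDualSup w u δ := by
  refine le_trans ?_ (le_ciSup (klDual_bddAbove u hw hw1 hδ) ⟨0, le_rfl⟩)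
  obtain ⟨y, hy⟩ := exists_weight_pos hw1
  have : Nonempty {y : Y // 0 < w y} := ⟨⟨y, hy⟩⟩
  simp only [klDual, if_true]
  exact le_ciInf fun y => hu y y.2

/-- The functional is monotone in u and commutes with adding constants. Passing to the supremum
makes it nonexpansive in u, which is the source of the γ-contraction of the empirical operator for
every sample. -/
theorem klDual_le_add {w u u' : Y → ℝ} {δ α c : ℝ} (hw : ∀ y, 0 ≤ w y) (hw1 : ∑ y, w y = 1)
    (hα : 0 ≤ α) (h : ∀ y, u y ≤ u' y + c) : klDual w u δ α ≤ klDual w u' δ α + c := by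
  unfold klDual
  split_ifs with h0
  · obtain ⟨y, hy⟩ := exists_weight_pos hw1
    have : Nonempty {y : Y // 0 < w y} := ⟨⟨y, hy⟩⟩
    rw [← sub_le_iff_le_add]
    refine le_ciInf fun y => ?_
    rw [sub_le_iff_le_add]
    exact (ciInf_le (Set.finite_range _).bddBelow y).trans (h y)
  · have hα' : 0 < α := lt_of_le_of_ne hα (Ne.symm h0)
    unfold expec
    have hZ := sum_weight_exp_pos hw hw1 (fun y => -u y / α)
    have hZ' := sum_weight_exp_pos hw hw1 (fun y => -u' y / α)
    have h1 : Real.exp (-c / α) * ∑ y, w y * Real.exp (-u' y / α)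
        ≤ ∑ y, w y * Real.exp (-u y / α) := by
      rw [Finset.mul_sum]
      refine Finset.sum_le_sum fun y _ => ?_
      rw [mul_left_comm, ← Real.exp_add]
      refine mul_le_mul_of_nonneg_left (Real.exp_le_exp.2 ?_) (hw y)
      rw [← add_div]
      gcongr
      linarith [h y]
    have h2 := Real.log_le_log (mul_pos (Real.exp_pos _) hZ') h1
    rw [Real.log_mul (Real.exp_pos _).ne' hZ'.ne', Real.log_exp] at h2
    have h3 := mul_le_mul_of_nonneg_left h2 hα'.le
    have h4 : α * (-c / α + Real.log (∑ y, w y * Real.exp (-u' y / α)))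
        = -c + α * Real.log (∑ y, w y * Real.exp (-u' y / α)) := by
      field_simp
    linarith

theorem klDualSup_le_add {w u u' : Y → ℝ} {δ c : ℝ} (hw : ∀ y, 0 ≤ w y) (hw1 : ∑ y, w y = 1)
    (hδ : 0 ≤ δ) (h : ∀ y, u y ≤ u' y + c) : klDualSup w u δ ≤ klDualSup w u' δ + c :=
  ciSup_le fun α => (klDual_le_add hw hw1 α.2 h).trans
    (by gcongr; exact le_ciSup (klDual_bddAbove u' hw hw1 hδ) α)

theorem abs_klDualSup_sub_le {w u u' : Y → ℝ} {δ c : ℝ} (hw : ∀ y, 0 ≤ w y)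
    (hw1 : ∑ y, w y = 1) (hδ : 0 ≤ δ) (h : ∀ y, |u y - u' y| ≤ c) :
    |klDualSup w u δ - klDualSup w u' δ| ≤ c := by
  rw [abs_le]
  have h1 := klDualSup_le_add (u := u) (u' := u') (c := c) hw hw1 hδ
    fun y => by linarith [(abs_le.1 (h y)).2]
  have h2 := klDualSup_le_add (u := u') (u' := u) (c := c) hw hw1 hδ
    fun y => by linarith [(abs_le.1 (h y)).1]
  constructor <;> linarith

/-! ### Elementary estimates for `klFun` -/

/-- Pointwise comparison of Hellinger distance and relative entropy: apply log y ≥ 1 - 1/y at y =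
√x. -/
theorem sq_sqrt_sub_one_le_klFun {x : ℝ} (hx : 0 < x) : (Real.sqrt x - 1) ^ 2 ≤ klFun x := by
  have hs := Real.sqrt_pos.2 hx
  have h1 := Real.one_sub_inv_le_log_of_pos hs
  have h2 : Real.log x = 2 * Real.log (Real.sqrt x) := by rw [Real.log_sqrt hx.le]; ring
  have h3 := Real.sq_sqrt hx.le
  rw [klFun_apply, h2]
  have h4 := mul_le_mul_of_nonneg_left h1 hx.le
  have h5 : x * (1 - (Real.sqrt x)⁻¹) = x - Real.sqrt x := by
    nth_rewrite 1 [← h3]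
    field_simp
    linear_combination h3
  nlinarith

/-- A second-order Taylor upper bound (the derivative of `klFun` is log) that needs no closeness of
x and y, since it is just log(y/x) ≤ y/x - 1. -/
theorem klFun_le_quadratic {x y : ℝ} (hx : 0 < x) (hy : 0 < y) :
    klFun y ≤ klFun x + Real.log x * (y - x) + (y - x) ^ 2 / x := by
  have h1 := Real.log_le_sub_one_of_pos (div_pos hy hx)
  rw [Real.log_div hy.ne' hx.ne'] at h1
  have h2 := mul_le_mul_of_nonneg_left h1 hy.le
  have h3 : (y - x) ^ 2 / x = y * (y / x - 1) - (y - x) := by field_simp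
  rw [klFun_apply, klFun_apply, h3]
  linarith

theorem sum_weight_klFun {w r : Y → ℝ} (hw1 : ∑ y, w y = 1) (hr1 : ∑ y, w y * r y = 1) :
    ∑ y, w y * klFun (r y) = ∑ y, w y * (r y * Real.log (r y)) := by
  simp only [klFun_apply, mul_sub, mul_add, Finset.sum_sub_distrib, Finset.sum_add_distrib,
    mul_one, hw1, hr1]
  ring

theorem mem_Icc_of_klFun_le {x : ℝ} (hx : 0 < x) (h : klFun x ≤ 1 / 47) :
    2 / 3 ≤ x ∧ x ≤ 4 / 3 := by
  have h1 := (sq_sqrt_sub_one_le_klFun hx).trans h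
  have h3 := Real.sq_sqrt hx.le
  have hs := Real.sqrt_nonneg x
  -- The bound 0.146² ≥ 1/47 holds, while 0.854² ≥ 2/3 and 1.146² ≤ 4/3.
  have h4 : |Real.sqrt x - 1| ≤ 0.146 := abs_le_of_sq_le_sq (by norm_num; linarith) (by norm_num)
  have h5 := abs_le.1 h4
  constructor
  · nlinarith [h5.1]
  · nlinarith [h5.2]

/-- An exponential tilt of `w` along a function that is not constant on the support of `w` can be
chosen to have any prescribed small relative entropy. -/
theorem exists_tilt {w u : Y → ℝ} {p δ : ℝ} (hw : ∀ y, 0 ≤ w y) (hw1 : ∑ y, w y = 1)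
    (hp : ∀ y, 0 < w y → p ≤ w y) (hδ : 0 < δ) (hδp : 4 * δ ≤ p) {y₀ y₁ : Y}
    (h₀ : 0 < w y₀) (h₁ : 0 < w y₁) (hu : u y₁ < u y₀) :
    ∃ l : ℝ, 0 < l ∧ ∑ y, w y * klFun (Real.exp (-(l * u y))
      / ∑ z, w z * Real.exp (-(l * u z))) = δ := by
  have hZ : ∀ l : ℝ, 0 < ∑ z, w z * Real.exp (-(l * u z)) := fun l =>
    sum_weight_exp_pos hw hw1 fun z => -(l * u z)
  have hcont : Continuous fun l : ℝ => ∑ y, w y * klFun (Real.exp (-(l * u y))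
      / ∑ z, w z * Real.exp (-(l * u z))) := by
    refine continuous_finsetSum _ fun y _ => continuous_const.mul (continuous_klFun.comp ?_)
    exact Continuous.div (by fun_prop) (by fun_prop) fun l => (hZ l).ne'
  set f := fun l : ℝ => ∑ y, w y * klFun (Real.exp (-(l * u y))
      / ∑ z, w z * Real.exp (-(l * u z))) with hf
  have hf0 : f 0 = 0 := by simp [hf, hw1, klFun_one]
  have hgap : 0 < u y₀ - u y₁ := by linarith
  -- At this tilt the atom `y₁` alone makes the normaliser at least four times the exponential at
  -- `y₀`. The density at `y₀` is then at most 1/4, where `klFun` is at least 1/4, so the entropy is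
  -- at least p/4 ≥ δ. The intermediate value theorem applies between 0 and Λ.
  set Λ := Real.log (4 / w y₁) / (u y₀ - u y₁) with hΛ
  have hw1' : w y₁ ≤ 1 := by
    rw [← hw1]; exact Finset.single_le_sum (fun y _ => hw y) (Finset.mem_univ y₁)
  have hΛ0 : 0 ≤ Λ := div_nonneg (Real.log_nonneg (by rw [le_div_iff₀ h₁]; linarith)) hgap.le
  have hρ : Real.exp (-(Λ * u y₀)) / (∑ z, w z * Real.exp (-(Λ * u z))) ≤ 1 / 4 := by
    rw [div_le_iff₀ (hZ Λ)]
    have h1 : w y₁ * Real.exp (-(Λ * u y₁)) ≤ ∑ z, w z * Real.exp (-(Λ * u z)) :=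
      Finset.single_le_sum (f := fun z => w z * Real.exp (-(Λ * u z)))
        (fun y _ => mul_nonneg (hw y) (Real.exp_pos _).le) (Finset.mem_univ y₁)
    have h2 : Real.exp (-(Λ * u y₀)) = w y₁ / 4 * Real.exp (-(Λ * u y₁)) := by
      have h3 : -(Λ * u y₀) = -Real.log (4 / w y₁) + -(Λ * u y₁) := by
        rw [hΛ]; field_simp; ring
      rw [h3, Real.exp_add, ← Real.log_inv, Real.exp_log (by positivity), inv_div]
    linarith
  have hfΛ : δ ≤ f Λ := by
    have hpos : 0 < Real.exp (-(Λ * u y₀)) / (∑ z, w z * Real.exp (-(Λ * u z))) :=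
      div_pos (Real.exp_pos _) (hZ Λ)
    have h1 := sq_sqrt_sub_one_le_klFun hpos
    have h2 : Real.sqrt (Real.exp (-(Λ * u y₀)) / (∑ z, w z * Real.exp (-(Λ * u z)))) ≤ 1 / 2 :=
      Real.sqrt_le_iff.2 ⟨by norm_num, hρ.trans (by norm_num)⟩
    have h3 : (1 : ℝ) / 4
        ≤ klFun (Real.exp (-(Λ * u y₀)) / (∑ z, w z * Real.exp (-(Λ * u z)))) := by
      nlinarith
    have h4 : w y₀ * klFun (Real.exp (-(Λ * u y₀)) / (∑ z, w z * Real.exp (-(Λ * u z)))) ≤ f Λ :=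
      Finset.single_le_sum (f := fun y => w y * klFun (Real.exp (-(Λ * u y))
        / ∑ z, w z * Real.exp (-(Λ * u z))))
        (fun y _ => mul_nonneg (hw y) (klFun_nonneg (div_pos (Real.exp_pos _) (hZ Λ)).le))
        (Finset.mem_univ y₀)
    have h5 := mul_le_mul (hp y₀ h₀) h3 (by norm_num) h₀.le
    linarith
  obtain ⟨l, hl, hfl⟩ := intermediate_value_Icc hΛ0 hcont.continuousOn
    ⟨by rw [hf0]; exact hδ.le, hfΛ⟩
  refine ⟨l, lt_of_le_of_ne hl.1 ?_, hfl⟩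
  rintro rfl
  rw [hf0] at hfl
  exact hδ.ne hfl

end KLDual

/-! ### Feasible perturbation of a density -/

section Expansion

open InformationTheory

variable {Y : Type*} [Fintype Y]

/-- A relative perturbation e vanishes off the support of w, so bounds on a are needed only on that
support. -/
theorem abs_sum_mul_le {w e a b : Y → ℝ} {t : ℝ} (hw : ∀ y, 0 ≤ w y)
    (he : ∀ y, |e y| ≤ t * w y) (h : ∀ y, 0 < w y → |a y| ≤ b y) :
    |∑ y, e y * a y| ≤ t * ∑ y, w y * b y := by
  rw [Finset.mul_sum]
  refine (Finset.abs_sum_le_sum_abs _ _).trans (Finset.sum_le_sum fun y _ => ?_)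
  rw [abs_mul]
  rcases (hw y).eq_or_lt with h0 | h0
  · have := he y
    rw [← h0, mul_zero] at this
    have h1 : |e y| = 0 := le_antisymm this (abs_nonneg _)
    simp [h1, ← h0]
  · rw [← mul_assoc]
    exact mul_le_mul (he y) (h y h0) (abs_nonneg _) ((abs_nonneg _).trans (he y))

theorem sq_sum_weight_le {w a : Y → ℝ} (hw : ∀ y, 0 ≤ w y) (hw1 : ∑ y, w y = 1) :
    (∑ y, w y * a y) ^ 2 ≤ ∑ y, w y * a y ^ 2 := by
  have h1 : 0 ≤ ∑ y, w y * (a y - ∑ z, w z * a z) ^ 2 :=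
    Finset.sum_nonneg fun y _ => mul_nonneg (hw y) (sq_nonneg _)
  have h2 : ∑ y, w y * (a y - ∑ z, w z * a z) ^ 2
      = ∑ y, w y * a y ^ 2 - (∑ y, w y * a y) ^ 2 := by
    set m := ∑ z, w z * a z with hm
    have : ∀ y, w y * (a y - m) ^ 2 = w y * a y ^ 2 - 2 * m * (w y * a y) + m ^ 2 * w y :=
      fun y => by ring
    simp only [this, Finset.sum_add_distrib, Finset.sum_sub_distrib, ← Finset.mul_sum, hw1, ← hm]
    ring
  linarith

/-- Near 1, log x and x - 1 are interchangeable up to a factor 2. This lets every error be measured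
by the single quantity ∑ w (ρ - 1) log ρ, uniformly as δ → 0. -/
theorem log_bounds_of_mem_Icc {x : ℝ} (h1 : 2 / 3 ≤ x) (h2 : x ≤ 4 / 3) :
    |Real.log x| ≤ 2 * |x - 1| ∧ |x - 1| ≤ 2 * |Real.log x|
      ∧ (x - 1) ^ 2 ≤ 2 * ((x - 1) * Real.log x) ∧ 0 ≤ (x - 1) * Real.log x := by
  have hx : 0 < x := by linarith
  have h3 := Real.log_le_sub_one_of_pos hx
  have h4 := Real.one_sub_inv_le_log_of_pos hx
  have h5 : 1 - x⁻¹ = (x - 1) / x := by field_simp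
  rw [h5, div_le_iff₀ hx] at h4
  rcases le_total 1 x with h | h
  · have h6 : 0 ≤ Real.log x := Real.log_nonneg h
    rw [abs_of_nonneg h6, abs_of_nonneg (by linarith : 0 ≤ x - 1)]
    refine ⟨by linarith, by nlinarith, by nlinarith, mul_nonneg (by linarith) h6⟩
  · have h6 : Real.log x ≤ 0 := Real.log_nonpos hx.le h
    rw [abs_of_nonpos h6, abs_of_nonpos (by linarith : x - 1 ≤ 0)]
    refine ⟨by nlinarith, by linarith, by nlinarith, mul_nonneg_of_nonpos_of_nonpos
      (by linarith) h6⟩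

/-- The mixing coefficient that makes the perturbed density feasible, with its error bounds. -/
theorem exists_mixing_coefficient {t B V s δ lb m z q a₁ : ℝ} (ht0 : 0 ≤ t) (ht : t ≤ 1 / 100)
    (hB0 : 0 < B) (hδ : 0 ≤ δ) (hδB : δ = B + lb) (hs0 : 0 ≤ s) (hs1 : s ≤ 1 / 3)
    (hsV : s ^ 2 ≤ V) (hVB : V ≤ 2 * B) (hlb0 : lb ≤ 0) (hmts : |m| ≤ t * s)
    (hzts : |z| ≤ 2 * t * s) (hqB : |q| ≤ t * B) (ha₁B : |a₁| ≤ t * δ) :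
    ∃ κ : ℝ, κ * B = a₁ - m * lb + 100 * t ^ 2 * B ∧ |κ| ≤ 3 * t ∧ |1 - κ| ≤ 2 ∧ |m| ≤ t / 2 ∧
      |κ * (m * lb)| ≤ 3 / 2 * (t ^ 2 * B) ∧ |κ * q| ≤ 3 * (t ^ 2 * B) ∧
      |(1 - κ) * (m * z)| ≤ 8 * (t ^ 2 * B) ∧ κ ^ 2 * V ≤ 18 * (t ^ 2 * B) ∧
      (1 - κ) ^ 2 * m ^ 2 ≤ 8 * (t ^ 2 * B) := by
  -- The quotient cancels the first-order change of the entropy. The slack 100 t² absorbs all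
  -- second-order terms, which amount to at most 90.5 t² B.
  obtain ⟨κ, hκ⟩ : ∃ κ : ℝ, κ = (a₁ - m * lb) / B + 100 * t ^ 2 := ⟨_, rfl⟩
  have hκB : κ * B = a₁ - m * lb + 100 * t ^ 2 * B := by
    rw [hκ, add_mul, div_mul_cancel₀ _ hB0.ne']
  have hm1 : |m| ≤ t / 2 := hmts.trans (by linarith [mul_le_mul_of_nonneg_left hs1 ht0])
  have hlbB : |lb| ≤ B := by rw [abs_of_nonpos hlb0]; linarith
  have hmlb : |m * lb| ≤ t / 2 * B := by
    rw [abs_mul]; exact mul_le_mul hm1 hlbB (abs_nonneg _) (by positivity)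
  have hκ3 : |κ| ≤ 3 * t := by
    have h1 : |κ * B| ≤ 3 * t * B := by
      rw [hκB]
      have h2 : t * δ ≤ t * B := mul_le_mul_of_nonneg_left (by linarith) ht0
      have h3 := abs_le.1 ha₁B
      have h4 := abs_le.1 hmlb
      have h5 : 100 * t ^ 2 * B ≤ t * B :=
        mul_le_mul_of_nonneg_right (by nlinarith only [ht0, ht]) hB0.le
      have h6 : 0 ≤ 100 * t ^ 2 * B := by positivity
      have h7 : 0 ≤ t * B := by positivity
      rw [abs_le]
      constructor <;> linarith
    rw [abs_mul, abs_of_pos hB0] at h1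
    exact le_of_mul_le_mul_right h1 hB0
  have hκ1 : |1 - κ| ≤ 2 := by
    have := abs_le.1 hκ3
    rw [abs_le]; constructor <;> linarith
  have hκm : |κ * (m * lb)| ≤ 3 / 2 * (t ^ 2 * B) := by
    rw [abs_mul]
    refine (mul_le_mul hκ3 hmlb (abs_nonneg _) (by positivity)).trans_eq ?_
    ring
  have hκq : |κ * q| ≤ 3 * (t ^ 2 * B) := by
    rw [abs_mul]
    refine (mul_le_mul hκ3 hqB (abs_nonneg _) (by positivity)).trans_eq ?_
    ring
  have hs2 : s ^ 2 ≤ 2 * B := hsV.trans hVB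
  have hmz : |(1 - κ) * (m * z)| ≤ 8 * (t ^ 2 * B) := by
    rw [abs_mul, abs_mul]
    have h1 : |m| * |z| ≤ t * s * (2 * t * s) :=
      mul_le_mul hmts hzts (abs_nonneg _) (by positivity)
    have h2 : t * s * (2 * t * s) ≤ 4 * (t ^ 2 * B) := by
      have := mul_le_mul_of_nonneg_left hs2 (sq_nonneg t)
      linarith only [this]
    calc |1 - κ| * (|m| * |z|) ≤ 2 * (4 * (t ^ 2 * B)) :=
          mul_le_mul hκ1 (h1.trans h2) (by positivity) (by norm_num)
      _ = _ := by ring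
  have hm2 : m ^ 2 ≤ 2 * (t ^ 2 * B) := by
    have h1 : m ^ 2 ≤ (t * s) ^ 2 := sq_le_sq' (abs_le.1 hmts).1 (abs_le.1 hmts).2
    have h2 := mul_le_mul_of_nonneg_left hs2 (sq_nonneg t)
    rw [mul_pow] at h1
    linarith only [h1, h2]
  have hκ2 : κ ^ 2 ≤ 9 * t ^ 2 := by
    have h1 : κ ^ 2 ≤ (3 * t) ^ 2 := sq_le_sq' (abs_le.1 hκ3).1 (abs_le.1 hκ3).2
    rwa [mul_pow, show (3 : ℝ) ^ 2 = 9 by norm_num] at h1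
  have h1κ2 : (1 - κ) ^ 2 ≤ 4 := by
    have h1 : (1 - κ) ^ 2 ≤ 2 ^ 2 := sq_le_sq' (abs_le.1 hκ1).1 (abs_le.1 hκ1).2
    linarith
  have hκV : κ ^ 2 * V ≤ 18 * (t ^ 2 * B) := by
    have h0 : 0 ≤ V := (sq_nonneg s).trans hsV
    calc κ ^ 2 * V ≤ 9 * t ^ 2 * (2 * B) := mul_le_mul hκ2 hVB h0 (by positivity)
      _ = _ := by ring
  have hκm2 : (1 - κ) ^ 2 * m ^ 2 ≤ 8 * (t ^ 2 * B) := by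
    calc (1 - κ) ^ 2 * m ^ 2 ≤ 4 * (2 * (t ^ 2 * B)) :=
          mul_le_mul h1κ2 hm2 (sq_nonneg _) (by norm_num)
      _ = _ := by ring
  exact ⟨κ, hκB, hκ3, hκ1, hm1, hκm, hκq, hmz, hκV, hκm2⟩

set_option maxHeartbeats 1000000 in
/-- A density near `ρ` that is feasible for the perturbed weights `v` and whose value agrees with
the one of `ρ` up to first order. -/
theorem exists_perturbed_density {w v ρ : Y → ℝ} {t δ : ℝ} (hw : ∀ y, 0 ≤ w y)
    (hw1 : ∑ y, w y = 1) (hv1 : ∑ y, v y = 1) (ht0 : 0 ≤ t) (ht : t ≤ 1 / 100)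
    (hvw : ∀ y, |v y - w y| ≤ t * w y) (hρ : ∀ y, 0 < w y → 2 / 3 ≤ ρ y ∧ ρ y ≤ 4 / 3)
    (hρ1 : ∑ y, w y * ρ y = 1) (hδ : 0 < δ) (hD : ∑ y, w y * klFun (ρ y) = δ) :
    ∃ r : Y → ℝ, (∀ y, 0 < v y → 0 ≤ r y) ∧ ∑ y, v y * r y = 1 ∧
      ∑ y, v y * klFun (r y) ≤ δ ∧
      ∑ y, (v y - w y) * (ρ y - 1) - 120 * t ^ 2 * ∑ y, w y * ((ρ y - 1) * Real.log (ρ y))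
        ≤ ∑ y, v y * r y * Real.log (ρ y) - ∑ y, w y * ρ y * Real.log (ρ y) := by
  obtain ⟨e, he⟩ : ∃ e : Y → ℝ, ∀ y, v y = w y + e y := ⟨fun y => v y - w y, fun y => by ring⟩
  have het : ∀ y, |e y| ≤ t * w y := fun y => by
    have := hvw y; rwa [he, add_sub_cancel_left] at this
  have he0 : ∑ y, e y = 0 := by
    have : ∑ y, v y = ∑ y, w y + ∑ y, e y := by simp only [he, Finset.sum_add_distrib]
    linarith
  have hpos : ∀ y, 0 < v y → 0 < w y := fun y hy => by
    refine (hw y).lt_of_ne fun h => ?_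
    have h1 := het y
    rw [← h, mul_zero, abs_nonpos_iff] at h1
    rw [he, ← h, h1] at hy
    simp at hy
  obtain ⟨g, hg⟩ : ∃ g : Y → ℝ, ∀ y, ρ y = 1 + g y := ⟨fun y => ρ y - 1, fun y => by ring⟩
  obtain ⟨l, hl⟩ : ∃ l : Y → ℝ, ∀ y, Real.log (ρ y) = l y := ⟨_, fun y => rfl⟩
  have hfacts : ∀ y, 0 < w y → |l y| ≤ 2 * |g y| ∧ g y ^ 2 ≤ 2 * (g y * l y) ∧ 0 ≤ g y * l y
      ∧ |g y| ≤ 1 / 3 := fun y hy => by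
    obtain ⟨h1, -, h3, h4⟩ := log_bounds_of_mem_Icc (hρ y hy).1 (hρ y hy).2
    have h5 := hρ y hy
    rw [hl, hg, add_sub_cancel_left] at *
    exact ⟨h1, h3, h4, abs_le.2 ⟨by linarith, by linarith⟩⟩
  have hkl : ∀ y, klFun (ρ y) = (1 + g y) * l y - g y := fun y => by
    rw [klFun_apply, hl, hg]; ring
  have hkl0 : ∀ y, 0 < w y → 0 ≤ klFun (ρ y) := fun y hy =>
    klFun_nonneg (by linarith [(hρ y hy).1])
  have hwg : ∑ y, w y * g y = 0 := by
    simp only [hg, mul_add, Finset.sum_add_distrib, mul_one, hw1] at hρ1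
    linarith
  set B := ∑ y, w y * (g y * l y) with hB
  set V := ∑ y, w y * g y ^ 2 with hV
  set m := ∑ y, e y * g y with hm
  set lb := ∑ y, w y * l y with hlb
  set a₁ := ∑ y, e y * klFun (ρ y) with ha₁
  set q := ∑ y, e y * (g y * l y) with hq
  set z := ∑ y, e y * l y with hz
  set s := ∑ y, w y * |g y| with hs
  have hs0 : 0 ≤ s := Finset.sum_nonneg fun y _ => mul_nonneg (hw y) (abs_nonneg _)
  have hsV : s ^ 2 ≤ V := by
    have := sq_sum_weight_le (a := fun y => |g y|) hw hw1
    simpa only [sq_abs] using this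
  have hs1 : s ≤ 1 / 3 := sum_weight_le_const hw hw1 fun y hy => (hfacts y hy).2.2.2
  have hVB : V ≤ 2 * B := by
    rw [hB, Finset.mul_sum]
    refine (sum_weight_le (b := fun y => 2 * (g y * l y)) hw fun y hy =>
      (hfacts y hy).2.1).trans_eq ?_
    exact Finset.sum_congr rfl fun y _ => by ring
  have hδB : δ = B + lb := by
    rw [← hD, hB, hlb, ← Finset.sum_add_distrib]
    simp only [hkl]
    have : ∑ y, w y * ((1 + g y) * l y - g y)
        = ∑ y, (w y * (g y * l y) + w y * l y) - ∑ y, w y * g y := by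
      rw [← Finset.sum_sub_distrib]
      exact Finset.sum_congr rfl fun y _ => by ring
    rw [this, hwg, sub_zero]
  have hlb0 : lb ≤ 0 := by
    rw [← hwg]
    refine sum_weight_le hw fun y hy => ?_
    have := Real.log_le_sub_one_of_pos (x := ρ y) (by linarith [(hρ y hy).1])
    rw [hl, hg] at this
    linarith
  have hB0 : 0 < B := by linarith
  have hmts : |m| ≤ t * s := abs_sum_mul_le hw het fun y _ => le_rfl
  have hzts : |z| ≤ 2 * t * s := by
    have := abs_sum_mul_le (a := l) (b := fun y => 2 * |g y|) hw het fun y hy => (hfacts y hy).1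
    refine this.trans_eq ?_
    rw [hs, Finset.mul_sum, Finset.mul_sum]
    exact Finset.sum_congr rfl fun y _ => by ring
  have hqB : |q| ≤ t * B := abs_sum_mul_le hw het fun y hy =>
    (abs_of_nonneg (hfacts y hy).2.2.1).le
  have ha₁B : |a₁| ≤ t * δ := by
    rw [← hD]
    exact abs_sum_mul_le hw het fun y hy => (abs_of_nonneg (hkl0 y hy)).le
  obtain ⟨κ, hκB, hκ3, hκ1, hm1, hκm, hκq, hmz, hκV, hκm2⟩ := exists_mixing_coefficient ht0 ht
    hB0 hδ.le hδB hs0 hs1 hsV hVB hlb0 hmts hzts hqB ha₁B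
  -- The v-mean of g is m, so d has v-mean m for every κ. Hence ρ - d is normalised under v whatever
  -- κ is, and κ remains free to tune the entropy.
  set d : Y → ℝ := fun y => κ * g y + (1 - κ) * m with hd
  have hvd : ∑ y, v y * d y = m := by
    have : ∀ y, v y * d y = κ * (w y * g y) + κ * (e y * g y) + (1 - κ) * m * v y := fun y => by
      simp only [hd, he]; ring
    simp only [this, Finset.sum_add_distrib, ← Finset.mul_sum, hwg, hv1, ← hm]
    ring
  have hvld : ∑ y, v y * (l y * d y)
      = κ * B + (1 - κ) * (m * lb) + κ * q + (1 - κ) * (m * z) := by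
    have : ∀ y, v y * (l y * d y) = κ * (w y * (g y * l y)) + (1 - κ) * m * (w y * l y)
        + κ * (e y * (g y * l y)) + (1 - κ) * m * (e y * l y) := fun y => by
      simp only [hd, he]; ring
    simp only [this, Finset.sum_add_distrib, ← Finset.mul_sum, ← hB, ← hlb, ← hq, ← hz]
    ring
  have hwd2 : ∑ y, w y * d y ^ 2 = κ ^ 2 * V + (1 - κ) ^ 2 * m ^ 2 := by
    have : ∀ y, w y * d y ^ 2 = κ ^ 2 * (w y * g y ^ 2) + 2 * κ * (1 - κ) * m * (w y * g y)
        + (1 - κ) ^ 2 * m ^ 2 * w y := fun y => by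
      simp only [hd]; ring
    simp only [this, Finset.sum_add_distrib, ← Finset.mul_sum, ← hV, hwg, hw1]
    ring
  have hdsmall : ∀ y, 0 < w y → |d y| ≤ 1 / 3 := fun y hy => by
    have h1 := (hfacts y hy).2.2.2
    have h2 : |κ * g y| ≤ 3 * t * (1 / 3) := by
      rw [abs_mul]; exact mul_le_mul hκ3 h1 (abs_nonneg _) (by positivity)
    have h3 : |(1 - κ) * m| ≤ 2 * (t / 2) := by
      rw [abs_mul]; exact mul_le_mul hκ1 hm1 (abs_nonneg _) (by norm_num)
    refine (abs_add_le _ _).trans ?_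
    linarith
  have hρd : ∀ y, 0 < w y → 0 < ρ y - d y := fun y hy => by
    linarith [(hρ y hy).1, (abs_le.1 (hdsmall y hy)).2]
  have hvρ : ∑ y, v y * ρ y = 1 + m := by
    have : ∀ y, v y * ρ y = w y * ρ y + e y + e y * g y := fun y => by
      rw [he, hg]; ring
    simp only [this, Finset.sum_add_distrib, hρ1, he0, ← hm]
    ring
  have hr1 : ∑ y, v y * (ρ y - d y) = 1 := by
    simp only [mul_sub, Finset.sum_sub_distrib, hvρ, hvd]
    ring
  have hv0 : ∀ y, 0 ≤ v y := fun y => by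
    have := (abs_le.1 (het y)).1
    have h2 : t * w y ≤ 1 * w y := mul_le_mul_of_nonneg_right (by linarith) (hw y)
    rw [he]; linarith
  have hv2 : ∀ y, v y ≤ 2 * w y := fun y => by
    have := (abs_le.1 (het y)).2
    have h2 : t * w y ≤ 1 * w y := mul_le_mul_of_nonneg_right (by linarith) (hw y)
    rw [he]; linarith
  refine ⟨fun y => ρ y - d y, fun y hy => (hρd y (hpos y hy)).le, hr1, ?_, ?_⟩
  · have h1 : ∑ y, v y * klFun (ρ y - d y)
        ≤ ∑ y, v y * (klFun (ρ y) - l y * d y + 3 / 2 * d y ^ 2) := by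
      refine sum_weight_le hv0 fun y hy => ?_
      have hy' := hpos y hy
      have hρ0 : 0 < ρ y := by linarith [(hρ y hy').1]
      refine (klFun_le_quadratic hρ0 (hρd y hy')).trans ?_
      have h2 : (ρ y - d y - ρ y) ^ 2 / ρ y ≤ 3 / 2 * d y ^ 2 := by
        rw [div_le_iff₀ hρ0, sub_sub_cancel_left, neg_sq]
        have h3 := mul_le_mul_of_nonneg_left (hρ y hy').1 (sq_nonneg (d y))
        linarith only [h3]
      rw [hl]
      linarith
    have h2 : ∑ y, v y * (klFun (ρ y) - l y * d y + 3 / 2 * d y ^ 2)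
        = δ + a₁ - ∑ y, v y * (l y * d y) + 3 / 2 * ∑ y, v y * d y ^ 2 := by
      rw [← hD, ha₁, ← Finset.sum_add_distrib, ← Finset.sum_sub_distrib, Finset.mul_sum,
        ← Finset.sum_add_distrib]
      exact Finset.sum_congr rfl fun y _ => by rw [he]; ring
    have h3 : ∑ y, v y * d y ^ 2 ≤ 2 * ∑ y, w y * d y ^ 2 := by
      rw [Finset.mul_sum]
      refine Finset.sum_le_sum fun y _ => ?_
      rw [← mul_assoc]
      exact mul_le_mul_of_nonneg_right (hv2 y) (sq_nonneg _)
    rw [hwd2] at h3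
    rw [h2, hvld, hκB] at h1
    have h4 := (abs_le.1 hκm).2
    have h5 := (abs_le.1 hκq).1
    have h6 := (abs_le.1 hmz).1
    have h7 : 0 ≤ t ^ 2 * B := by positivity
    linarith
  · have h1 : ∑ y, v y * (ρ y - d y) * Real.log (ρ y) - ∑ y, w y * ρ y * Real.log (ρ y)
        = a₁ + m - ∑ y, v y * (l y * d y) := by
      have : a₁ + m = ∑ y, e y * (ρ y * l y) - ∑ y, e y * 0 := by
        rw [ha₁, hm, ← Finset.sum_add_distrib, ← Finset.sum_sub_distrib]
        refine Finset.sum_congr rfl fun y _ => ?_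
        rw [hkl, hg]; ring
      rw [this]
      simp only [← Finset.sum_sub_distrib]
      exact Finset.sum_congr rfl fun y _ => by rw [hl, he]; ring
    have h2 : ∑ y, (v y - w y) * (ρ y - 1) = m :=
      Finset.sum_congr rfl fun y _ => by rw [he, hg]; ring
    have h3 : ∑ y, w y * ((ρ y - 1) * Real.log (ρ y)) = B :=
      Finset.sum_congr rfl fun y _ => by rw [hl, hg]; ring
    rw [h1, h2, h3, hvld, hκB]
    -- The loss is the slack 100 t² B plus 3/2 + 3 + 8 from the cross terms, within the allowed 120
    -- t² B.
    have h4 := (abs_le.1 hκm).1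
    have h5 := (abs_le.1 hκq).2
    have h6 := (abs_le.1 hmz).2
    have h7 : 0 ≤ t ^ 2 * B := by positivity
    linarith

end Expansion

/-! ### Strong duality and first-order expansion of the dual value -/

section Duality

open InformationTheory

variable {Y : Type*} [Fintype Y]

/-- Strong duality for small KL radii, together with a first-order expansion of the dual value
around `w` whose remainder is quadratic in the relative perturbation, uniformly in `δ`. -/
theorem exists_klDualSup_expansion {w u : Y → ℝ} {p δ H : ℝ} (hw : ∀ y, 0 ≤ w y)
    (hw1 : ∑ y, w y = 1) (hp : ∀ y, 0 < w y → p ≤ w y) (hδ : 0 < δ) (hδp : 47 * δ ≤ p)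
    (hu0 : ∀ y, 0 ≤ u y) (huH : ∀ y, u y ≤ H) :
    ∃ ρ L : Y → ℝ, (∀ y, 0 ≤ ρ y) ∧ ∑ y, w y * ρ y = 1 ∧ ∑ y, w y * klFun (ρ y) ≤ δ ∧
      klDualSup w u δ = ∑ y, w y * ρ y * u y ∧ (∀ y, |L y| ≤ 2 * H) ∧
      ∀ (v : Y → ℝ) (t : ℝ), (∀ y, 0 ≤ v y) → ∑ y, v y = 1 → 0 ≤ t → t ≤ 1 / 100 →
        (∀ y, |v y - w y| ≤ t * w y) →
        |klDualSup v u δ - klDualSup w u δ - ∑ y, (v y - w y) * L y| ≤ 40 * t ^ 2 * H := by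
  obtain ⟨y₁, hy₁⟩ := exists_weight_pos hw1
  have hH : 0 ≤ H := (hu0 y₁).trans (huH y₁)
  have supp : ∀ (v : Y → ℝ) (t : ℝ), (∀ y, |v y - w y| ≤ t * w y) → ∀ y, 0 < v y → 0 < w y :=
    fun v t hv y hy => by
      refine (hw y).lt_of_ne fun h => ?_
      have h1 := hv y
      rw [← h, mul_zero, abs_nonpos_iff] at h1
      linarith
  -- If u is constant on the support, tilting changes nothing and cannot reach entropy δ. The dual
  -- value is then that constant, for v as well as for w.
  by_cases hc : ∀ y, 0 < w y → u y = u y₁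
  · have hval : ∀ v : Y → ℝ, (∀ y, 0 ≤ v y) → ∑ y, v y = 1 → (∀ y, 0 < v y → 0 < w y) →
        klDualSup v u δ = u y₁ := fun v hv hv1 hs =>
      le_antisymm (klDualSup_le_const hv hv1 hδ.le fun y hy => (hc y (hs y hy)).le)
        (const_le_klDualSup hv hv1 hδ.le fun y hy => (hc y (hs y hy)).ge)
    refine ⟨fun _ => 1, fun _ => 0, fun _ => zero_le_one, by simpa, by simpa [klFun_one] using hδ.le,
      ?_, fun y => by simpa using hH, fun v t hv hv1 ht0 ht hvw => ?_⟩
    · rw [hval w hw hw1 fun y hy => hy]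
      simp only [mul_one]
      exact le_antisymm (const_le_sum_weight hw hw1 fun y hy => (hc y hy).ge)
        (sum_weight_le_const hw hw1 fun y hy => (hc y hy).le)
    · rw [hval w hw hw1 fun y hy => hy, hval v hv hv1 (supp v t hvw)]
      simp only [mul_zero, Finset.sum_const_zero, sub_self, abs_zero]
      positivity
  push Not at hc
  obtain ⟨y₂, hy₂, hne⟩ := hc
  have hp0 : 4 * δ ≤ p := by linarith
  obtain ⟨l, hl, hDl⟩ : ∃ l : ℝ, 0 < l ∧ ∑ y, w y * klFun (Real.exp (-(l * u y))
      / ∑ z, w z * Real.exp (-(l * u z))) = δ := by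
    rcases lt_or_gt_of_ne hne with h | h
    · exact exists_tilt hw hw1 hp hδ hp0 hy₁ hy₂ h
    · exact exists_tilt hw hw1 hp hδ hp0 hy₂ hy₁ h
  have hZ := sum_weight_exp_pos hw hw1 fun z => -(l * u z)
  set Z := ∑ z, w z * Real.exp (-(l * u z)) with hZdef
  obtain ⟨ρ, hρ⟩ : ∃ ρ : Y → ℝ, ∀ y, ρ y = Real.exp (-(l * u y)) / Z := ⟨_, fun y => rfl⟩
  simp only [← hρ] at hDl
  have hρ0 : ∀ y, 0 < ρ y := fun y => by rw [hρ]; positivity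
  have hlog : ∀ y, Real.log (ρ y) = -(l * u y) - Real.log Z := fun y => by
    rw [hρ, Real.log_div (Real.exp_pos _).ne' hZ.ne', Real.log_exp]
  have hρ1 : ∑ y, w y * ρ y = 1 := by
    simp only [hρ, ← mul_div_assoc]
    rw [← Finset.sum_div, div_self hZ.ne']
  have hρb : ∀ y, 0 < w y → 2 / 3 ≤ ρ y ∧ ρ y ≤ 4 / 3 := fun y hy => by
    refine mem_Icc_of_klFun_le (hρ0 y) ?_
    have h1 : w y * klFun (ρ y) ≤ δ := by
      rw [← hDl]
      exact Finset.single_le_sum (f := fun y => w y * klFun (ρ y))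
        (fun y _ => mul_nonneg (hw y) (klFun_nonneg (hρ0 y).le)) (Finset.mem_univ y)
    have h2 := mul_le_mul_of_nonneg_right (hp y hy) (klFun_nonneg (hρ0 y).le)
    have h3 : klFun (ρ y) * (47 * δ) ≤ δ := by
      have := mul_le_mul_of_nonneg_right hδp (klFun_nonneg (hρ0 y).le)
      linarith
    have h4 : (klFun (ρ y) * 47) * δ ≤ 1 * δ := by linarith
    have := le_of_mul_le_mul_right h4 hδ
    linarith
  have hZ1 : Z ≤ 1 := sum_weight_le_const hw hw1 fun y _ => by
    rw [← Real.exp_zero]; exact Real.exp_le_exp.2 (by have := mul_nonneg hl.le (hu0 y); linarith)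
  have hZH : Real.exp (-(l * H)) ≤ Z := const_le_sum_weight hw hw1 fun y _ =>
    Real.exp_le_exp.2 (by have := mul_le_mul_of_nonneg_left (huH y) hl.le; linarith)
  have hlogZ0 : Real.log Z ≤ 0 := Real.log_nonpos hZ.le hZ1
  have hlogZ1 : -(l * H) ≤ Real.log Z := by
    rw [← Real.log_exp (-(l * H))]; exact Real.log_le_log (Real.exp_pos _) hZH
  have hlogb : ∀ y, |Real.log (ρ y)| ≤ l * H := fun y => by
    have h1 := mul_le_mul_of_nonneg_left (huH y) hl.le
    have h2 := mul_nonneg hl.le (hu0 y)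
    rw [hlog, abs_le]
    constructor <;> linarith
  set F := ∑ y, w y * ρ y * u y with hF
  -- Since log ρ is affine in u with slope -l, expected values of u can be read off from those of
  -- log ρ.
  have hsumlog : ∀ v r : Y → ℝ, ∑ y, v y * r y = 1 →
      ∑ y, v y * r y * Real.log (ρ y) = -(l * ∑ y, v y * r y * u y) - Real.log Z := by
    intro v r h
    have : ∀ y, v y * r y * Real.log (ρ y)
        = -(l * (v y * r y * u y)) - Real.log Z * (v y * r y) := fun y => by rw [hlog]; ring
    simp only [this, Finset.sum_sub_distrib, Finset.sum_neg_distrib, ← Finset.mul_sum, h]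
    ring
  have hδF : δ = -(l * F) - Real.log Z := by
    rw [← hDl, sum_weight_klFun hw1 hρ1, ← hsumlog w ρ hρ1]
    exact Finset.sum_congr rfl fun y _ => by ring
  -- l⁻¹ is the optimal multiplier for w. Using it unchanged for v gives a lower bound on the dual
  -- value for v.
  have hdual : ∀ v : Y → ℝ, (∀ y, 0 ≤ v y) → ∑ y, v y = 1 →
      klDual v u δ l⁻¹ = F - l⁻¹ * Real.log (∑ y, v y * ρ y) := by
    intro v hv hv1
    have h1 : ∑ y, v y * Real.exp (-u y / l⁻¹) = Z * ∑ y, v y * ρ y := by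
      rw [Finset.mul_sum]
      refine Finset.sum_congr rfl fun y _ => ?_
      rw [hρ, div_inv_eq_mul, neg_mul, mul_comm (u y)]
      field_simp
    have h2 : 0 < ∑ y, v y * ρ y := by
      have h3 := sum_weight_exp_pos hv hv1 fun y => -u y / l⁻¹
      rw [h1] at h3
      exact pos_of_mul_pos_right h3 hZ.le
    rw [klDual, if_neg (inv_pos.2 hl).ne', expec, h1, Real.log_mul hZ.ne' h2.ne', hδF]
    field_simp
    ring
  have hsup : ∀ v : Y → ℝ, (∀ y, 0 ≤ v y) → ∑ y, v y = 1 →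
      F - l⁻¹ * Real.log (∑ y, v y * ρ y) ≤ klDualSup v u δ := fun v hv hv1 => by
    rw [← hdual v hv hv1]
    exact le_ciSup (klDual_bddAbove u hv hv1 hδ.le) ⟨l⁻¹, (inv_pos.2 hl).le⟩
  have hFeq : klDualSup w u δ = F := by
    refine le_antisymm (klDualSup_le_of_density hw hw1 (fun y _ => (hρ0 y).le) hρ1 ?_) ?_
    · rw [← sum_weight_klFun hw1 hρ1, hDl]
    · simpa [hρ1] using hsup w hw hw1
  -- L is the influence function -(ρ - 1)/l. As |ρ - 1| ≤ 2 |log ρ| ≤ 2 l H on the support, the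
  -- factor l cancels and the bound 2H does not depend on δ.
  refine ⟨ρ, fun y => if 0 < w y then -(l⁻¹ * (ρ y - 1)) else 0, fun y => (hρ0 y).le, hρ1, hDl.le,
    hFeq, fun y => ?_, fun v t hv hv1 ht0 ht hvw => ?_⟩
  · dsimp only
    split_ifs with hy
    · have h1 := (log_bounds_of_mem_Icc (hρb y hy).1 (hρb y hy).2).2.1
      rw [abs_neg, abs_mul, abs_of_pos (inv_pos.2 hl), inv_mul_le_iff₀ hl]
      linarith [hlogb y]
    · rw [abs_zero]; positivity
  · have hL : ∑ y, (v y - w y) * (if 0 < w y then -(l⁻¹ * (ρ y - 1)) else 0)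
        = -(l⁻¹ * ∑ y, (v y - w y) * (ρ y - 1)) := by
      rw [Finset.mul_sum, ← Finset.sum_neg_distrib]
      refine Finset.sum_congr rfl fun y _ => ?_
      split_ifs with hy
      · ring
      · have h0 : w y = 0 := le_antisymm (not_lt.1 hy) (hw y)
        have h1 := hvw y
        rw [h0, mul_zero, abs_nonpos_iff] at h1
        rw [h0, h1]; ring
    have hvρ : ∑ y, (v y - w y) * (ρ y - 1) = ∑ y, v y * ρ y - 1 := by
      have : ∀ y, (v y - w y) * (ρ y - 1) = v y * ρ y - w y * ρ y - v y + w y :=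
        fun y => by ring
      simp only [this, Finset.sum_add_distrib, Finset.sum_sub_distrib, hρ1, hv1, hw1]
      ring
    rw [hL, hFeq, abs_le]
    constructor
    · have h1 := hsup v hv hv1
      have h2 : 0 < ∑ y, v y * ρ y := by
        obtain ⟨y, hy⟩ := exists_weight_pos hv1
        exact Finset.sum_pos' (fun y _ => mul_nonneg (hv y) (hρ0 y).le)
          ⟨y, Finset.mem_univ y, mul_pos hy (hρ0 y)⟩
      have h3 := mul_le_mul_of_nonneg_left (Real.log_le_sub_one_of_pos h2) (inv_pos.2 hl).le
      have h4 : 0 ≤ 40 * t ^ 2 * H := by positivity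
      rw [hvρ]
      linarith
    · obtain ⟨r, hr0, hr1, hrD, hrV⟩ :=
        exists_perturbed_density hw hw1 hv1 ht0 ht hvw hρb hρ1 hδ hDl
      have h1 : klDualSup v u δ ≤ ∑ y, v y * r y * u y :=
        klDualSup_le_of_density hv hv1 hr0 hr1 (by rwa [← sum_weight_klFun hv1 hr1])
      rw [hsumlog v r hr1, hsumlog w ρ hρ1] at hrV
      -- With |ρ - 1| ≤ 1/3, the remainder 120 t² B becomes 40 t² l H, and dividing by l gives 40 t²
      -- H.
      have hB : ∑ y, w y * ((ρ y - 1) * Real.log (ρ y)) ≤ 1 / 3 * (l * H) :=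
        sum_weight_le_const hw hw1 fun y hy => by
          refine (le_abs_self _).trans ?_
          rw [abs_mul]
          have h2 := hρb y hy
          exact mul_le_mul (abs_le.2 ⟨by linarith, by linarith⟩) (hlogb y) (abs_nonneg _)
            (by norm_num)
      have h3 := mul_le_mul_of_nonneg_left hB (by positivity : 0 ≤ 120 * t ^ 2)
      have h4 : l * (∑ y, v y * r y * u y - F + l⁻¹ * ∑ y, (v y - w y) * (ρ y - 1))
          ≤ l * (40 * t ^ 2 * H) := by
        have : l * (∑ y, v y * r y * u y - F + l⁻¹ * ∑ y, (v y - w y) * (ρ y - 1))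
            = l * ∑ y, v y * r y * u y - l * F + ∑ y, (v y - w y) * (ρ y - 1) := by
          field_simp
        rw [this]
        linarith
      have h5 := le_of_mul_le_mul_left h4 hl
      linarith

end Duality

/-! ### KL balls in terms of densities -/

section KLBall

open InformationTheory

variable {Y : Type*}

theorem massOf_nonneg (μ : PMF Y) (y : Y) : 0 ≤ massOf μ y := ENNReal.toReal_nonneg

theorem ofReal_massOf (μ : PMF Y) (y : Y) : ENNReal.ofReal (massOf μ y) = μ y :=
  ENNReal.ofReal_toReal (μ.apply_ne_top y)

theorem mem_support_of_massOf_pos {μ : PMF Y} {y : Y} (h : 0 < massOf μ y) : y ∈ μ.support := by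
  intro h0
  simp only [massOf, h0, ENNReal.toReal_zero, lt_irrefl] at h

variable [MeasurableSpace Y] [MeasurableSingletonClass Y]

theorem toMeasure_singleton (μ : PMF Y) (y : Y) :
    μ.toMeasure {y} = ENNReal.ofReal (massOf μ y) := by
  rw [ofReal_massOf, μ.toMeasure_apply_singleton y (measurableSet_singleton y)]

variable [Fintype Y]

theorem klDiv_toMeasure {μ' μ : PMF Y} {r : Y → ℝ} (hr : ∀ y, 0 ≤ r y)
    (h : ∀ y, massOf μ' y = massOf μ y * r y) :
    klDiv μ'.toMeasure μ.toMeasure = ENNReal.ofReal (∑ y, massOf μ y * klFun (r y)) := by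
  have hd : μ'.toMeasure = μ.toMeasure.withDensity (fun y => ENNReal.ofReal (r y)) := by
    refine Measure.ext_iff_singleton.2 fun y => ?_
    rw [withDensity_apply _ (measurableSet_singleton y), lintegral_singleton,
      toMeasure_singleton, toMeasure_singleton, h, mul_comm, ENNReal.ofReal_mul (hr y)]
  have hac : μ'.toMeasure ≪ μ.toMeasure := by
    rw [hd]; exact withDensity_absolutelyContinuous _ _
  have hrn := Measure.rnDeriv_withDensity μ.toMeasure
    (f := fun y => ENNReal.ofReal (r y)) (measurable_of_finite _)
  rw [klDiv_eq_lintegral_klFun_of_ac hac, hd,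
    lintegral_congr_ae (g := fun y => ENNReal.ofReal (klFun (r y))), lintegral_fintype,
    ENNReal.ofReal_sum_of_nonneg fun y _ => mul_nonneg (massOf_nonneg μ y) (klFun_nonneg (hr y))]
  · refine Finset.sum_congr rfl fun y _ => ?_
    rw [toMeasure_singleton, mul_comm, ENNReal.ofReal_mul (massOf_nonneg μ y)]
  · filter_upwards [hrn] with y hy
    rw [hy, ENNReal.toReal_ofReal (hr y)]

/-- Finite divergence forces absolute continuity, so the ratio of masses is a density; its value 0/0
= 0 off the support is harmless. -/
theorem exists_density_of_mem_klBall {μ' μ : PMF Y} {δ : ℝ} (hδ : 0 ≤ δ) (h : μ' ∈ klBall μ δ) :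
    ∃ r : Y → ℝ, (∀ y, 0 ≤ r y) ∧ (∀ y, massOf μ' y = massOf μ y * r y) ∧
      ∑ y, massOf μ y * klFun (r y) ≤ δ := by
  have hle : klDiv μ'.toMeasure μ.toMeasure ≤ ENNReal.ofReal δ := h
  have hac : μ'.toMeasure ≪ μ.toMeasure :=
    (klDiv_ne_top_iff.1 (ne_top_of_le_ne_top ENNReal.ofReal_ne_top hle)).1
  have hr : ∀ y, massOf μ' y = massOf μ y * (massOf μ' y / massOf μ y) := fun y => by
    by_cases h0 : massOf μ y = 0
    · have h1 : μ.toMeasure {y} = 0 := by rw [toMeasure_singleton, h0, ENNReal.ofReal_zero]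
      have h2 := hac h1
      rw [toMeasure_singleton, ENNReal.ofReal_eq_zero] at h2
      rw [h0, zero_mul]
      exact le_antisymm h2 (massOf_nonneg μ' y)
    · field_simp
  have hr0 : ∀ y, 0 ≤ massOf μ' y / massOf μ y := fun y =>
    div_nonneg (massOf_nonneg μ' y) (massOf_nonneg μ y)
  refine ⟨_, hr0, hr, ?_⟩
  rw [klDiv_toMeasure hr0 hr] at hle
  exact (ENNReal.ofReal_le_ofReal_iff hδ).1 hle

theorem klDualSup_le_of_mem_klBall {μ' μ : PMF Y} {δ : ℝ} (u : Y → ℝ) (hδ : 0 ≤ δ)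
    (h : μ' ∈ klBall μ δ) : klDualSup (massOf μ) u δ ≤ expec (massOf μ') u := by
  obtain ⟨r, hr, hμ', hD⟩ := exists_density_of_mem_klBall hδ h
  have hr1 : ∑ y, massOf μ y * r y = 1 := by simp only [← hμ', massOf_sum]
  refine (klDualSup_le_of_density (massOf_nonneg μ) (massOf_sum μ) (fun y _ => hr y) hr1
    (by rwa [← sum_weight_klFun (massOf_sum μ) hr1])).trans_eq ?_
  exact Finset.sum_congr rfl fun y _ => by rw [hμ']

theorem exists_mem_klBall_eq_klDualSup {μ : PMF Y} {u : Y → ℝ} {p δ H : ℝ}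
    (hp : ∀ y, 0 < massOf μ y → p ≤ massOf μ y) (hδ : 0 < δ) (hδp : 47 * δ ≤ p)
    (hu0 : ∀ y, 0 ≤ u y) (huH : ∀ y, u y ≤ H) :
    ∃ μ' ∈ klBall μ δ, expec (massOf μ') u = klDualSup (massOf μ) u δ := by
  obtain ⟨ρ, -, hρ0, hρ1, hD, hF, -⟩ := exists_klDualSup_expansion (massOf_nonneg μ)
    (massOf_sum μ) hp hδ hδp hu0 huH
  have h0 : ∀ y, 0 ≤ massOf μ y * ρ y := fun y => mul_nonneg (massOf_nonneg μ y) (hρ0 y)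
  set μ' : PMF Y := PMF.ofFintype (fun y => ENNReal.ofReal (massOf μ y * ρ y)) (by
    rw [← ENNReal.ofReal_sum_of_nonneg fun y _ => h0 y, hρ1, ENNReal.ofReal_one]) with hμ'
  have hm : ∀ y, massOf μ' y = massOf μ y * ρ y := fun y => by
    rw [massOf, hμ', PMF.ofFintype_apply, ENNReal.toReal_ofReal (h0 y)]
  refine ⟨μ', ?_, ?_⟩
  · change klDiv μ'.toMeasure μ.toMeasure ≤ ENNReal.ofReal δ
    rw [klDiv_toMeasure hρ0 hm]
    exact ENNReal.ofReal_le_ofReal hD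
  · rw [hF]
    exact Finset.sum_congr rfl fun y _ => by rw [hm]

end KLBall

/-! ### Bounds on the model and the dual form of the Bellman operator -/

namespace RewardMDP

variable {S A : Type*} (M : RewardMDP S A)

theorem pMin_pos_of_lt {M : RewardMDP S A} {δ : ℝ} (hδ : 0 < δ)
    (h : δ < -Real.log (1 - 1 / 48 * M.pMin)) : 0 < M.pMin := by
  by_contra! hp
  have := Real.log_nonneg (by linarith : (1 : ℝ) ≤ 1 - 1 / 48 * M.pMin)
  linarith

/-- From -log y ≤ 1/y - 1 at y = 1 - p/48, together with (1 - p/48)(1 + p/47) ≥ 1 for 0 < p ≤ 1. -/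
theorem delta_le_of_lt_log {p δ : ℝ} (hp0 : 0 < p) (hp1 : p ≤ 1)
    (h : δ < -Real.log (1 - 1 / 48 * p)) : 47 * δ ≤ p := by
  have h0 : 0 < 1 - 1 / 48 * p := by linarith
  have h1 := Real.one_sub_inv_le_log_of_pos h0
  have h2 : (1 - 1 / 48 * p)⁻¹ ≤ 1 + p / 47 := by
    rw [inv_le_iff_one_le_mul₀ h0]
    nlinarith
  linarith

variable [Fintype S]

theorem pMin_le_massOf [Fintype A] (s : S) (a : A) :
    (∀ r, 0 < massOf (M.ν s a) r → M.pMin ≤ massOf (M.ν s a) r) ∧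
      ∀ s', 0 < massOf (M.p s a) s' → M.pMin ≤ massOf (M.p s a) s' := by
  have h := ciInf_le (Set.finite_range fun x : S × A =>
    min (⨅ r : (M.ν x.1 x.2).support, massOf (M.ν x.1 x.2) r)
    (⨅ s' : (M.p x.1 x.2).support, massOf (M.p x.1 x.2) s')).bddBelow (s, a)
  constructor
  · intro r hr
    refine (h.trans (min_le_left _ _)).trans ?_
    exact ciInf_le (f := fun r : (M.ν s a).support => massOf (M.ν s a) r)
      (Set.finite_range _).bddBelow ⟨r, mem_support_of_massOf_pos hr⟩
  · intro r hr
    refine (h.trans (min_le_right _ _)).trans ?_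
    exact ciInf_le (f := fun r : (M.p s a).support => massOf (M.p s a) r)
      (Set.finite_range _).bddBelow ⟨r, mem_support_of_massOf_pos hr⟩

theorem pMin_le_one [Fintype A] [Nonempty S] [Nonempty A] : M.pMin ≤ 1 := by
  obtain ⟨s⟩ := ‹Nonempty S›
  obtain ⟨a⟩ := ‹Nonempty A›
  obtain ⟨y, hy⟩ := exists_weight_pos (massOf_sum (M.p s a))
  refine ((M.pMin_le_massOf s a).2 y hy).trans ?_
  rw [← massOf_sum (M.p s a)]
  exact Finset.single_le_sum (fun y _ => massOf_nonneg _ y) (Finset.mem_univ y)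

variable [MeasurableSpace S]

/-- Evaluate the fixed-point equation at a minimiser and a maximiser of `vStar`; for the upper bound
the adversary plays the nominal laws. -/
theorem vStar_mem_Icc [Fintype A] [Nonempty A] (δ : ℝ) (hR : ∀ r ∈ M.R, r ≤ 1) (s : S) :
    0 ≤ M.vStar δ s ∧ M.vStar δ s ≤ 1 / (1 - M.γ) := by
  have hγ := M.γ_pos
  have hγ1 : 0 < 1 - M.γ := by linarith [M.γ_lt_one]
  have hbdd : ∀ (s : S) (a : A) (c : ℝ), (∀ s, c ≤ M.vStar δ s) → ∀ x : M.Adversary δ s a,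
      M.γ * c ≤ expec (massOf x.2.1) (fun r : M.R => (r : ℝ))
        + M.γ * expec (massOf x.1.1) (M.vStar δ) := fun s a c hc x => by
    have h1 : 0 ≤ expec (massOf x.2.1) (fun r : M.R => (r : ℝ)) :=
      const_le_sum_weight (massOf_nonneg _) (massOf_sum _) fun r _ => M.R_nonneg r r.2
    have h2 : c ≤ expec (massOf x.1.1) (M.vStar δ) :=
      const_le_sum_weight (massOf_nonneg _) (massOf_sum _) fun r _ => hc r
    have h3 := mul_le_mul_of_nonneg_left h2 hγ.le
    linarith
  have hne : Nonempty S := ⟨s⟩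
  obtain ⟨s₀, hs₀⟩ := Finite.exists_min (M.vStar δ)
  obtain ⟨s₁, hs₁⟩ := Finite.exists_max (M.vStar δ)
  have h0 : M.γ * M.vStar δ s₀ ≤ M.vStar δ s₀ := by
    conv_rhs => rw [M.vStar_eq_bellman δ]
    obtain ⟨a⟩ := ‹Nonempty A›
    exact (le_ciInf (hbdd s₀ a _ hs₀)).trans
      (Finset.le_sup' (fun a => M.robustBackup δ (M.vStar δ) s₀ a) (Finset.mem_univ a))
  have h1 : M.vStar δ s₁ ≤ 1 + M.γ * M.vStar δ s₁ := by
    conv_lhs => rw [M.vStar_eq_bellman δ]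
    refine Finset.sup'_le _ _ fun a _ => ?_
    refine (ciInf_le ⟨_, by rintro _ ⟨x, rfl⟩; exact hbdd s₁ a _ hs₀ x⟩
      (⟨_, self_mem_klBall _ δ⟩, ⟨_, self_mem_klBall _ δ⟩)).trans ?_
    refine add_le_add ?_ (mul_le_mul_of_nonneg_left ?_ hγ.le)
    · exact sum_weight_le_const (massOf_nonneg _) (massOf_sum _) fun r _ => hR r r.2
    · exact sum_weight_le_const (massOf_nonneg _) (massOf_sum _) fun r _ => hs₁ r
  have h0' : 0 ≤ M.vStar δ s₀ := by nlinarith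
  refine ⟨h0'.trans (hs₀ s), (hs₁ s).trans ?_⟩
  rw [le_div_iff₀ hγ1]
  linarith

theorem valueOf_qStar [Fintype A] [Nonempty A] (δ : ℝ) : valueOf (M.qStar δ) = M.vStar δ :=
  (M.vStar_eq_bellman δ).symm

variable [MeasurableSingletonClass S]

/-- Dual form of the robust Bellman operator. -/
theorem robustBackup_eq_klDualSup [Fintype A] {δ H : ℝ} {v : S → ℝ} (hδ : 0 < δ)
    (hδp : 47 * δ ≤ M.pMin) (hR : ∀ r ∈ M.R, r ≤ 1) (hv0 : ∀ s, 0 ≤ v s) (hvH : ∀ s, v s ≤ H)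
    (s : S) (a : A) :
    M.robustBackup δ v s a = klDualSup (massOf (M.ν s a)) (fun r : M.R => (r : ℝ)) δ
      + M.γ * klDualSup (massOf (M.p s a)) v δ := by
  have hle : ∀ x : M.Adversary δ s a,
      klDualSup (massOf (M.ν s a)) (fun r : M.R => (r : ℝ)) δ
        + M.γ * klDualSup (massOf (M.p s a)) v δ
      ≤ expec (massOf x.2.1) (fun r : M.R => (r : ℝ)) + M.γ * expec (massOf x.1.1) v := fun x =>
    add_le_add (klDualSup_le_of_mem_klBall _ hδ.le x.2.2)
      (mul_le_mul_of_nonneg_left (klDualSup_le_of_mem_klBall _ hδ.le x.1.2) M.γ_pos.le)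
  refine le_antisymm ?_ (le_ciInf hle)
  obtain ⟨ν', hν', hνe⟩ := exists_mem_klBall_eq_klDualSup (u := fun r : M.R => (r : ℝ))
    (M.pMin_le_massOf s a).1 hδ hδp (fun r => M.R_nonneg r r.2) (fun r => hR r r.2)
  obtain ⟨p', hp', hpe⟩ := exists_mem_klBall_eq_klDualSup (u := v)
    (M.pMin_le_massOf s a).2 hδ hδp hv0 hvH
  rw [← hνe, ← hpe]
  exact ciInf_le (f := fun x : M.Adversary δ s a =>
      expec (massOf x.2.1) (fun r : M.R => (r : ℝ)) + M.γ * expec (massOf x.1.1) v)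
    ⟨_, by rintro _ ⟨x, rfl⟩; exact hle x⟩ (⟨p', hp'⟩, ⟨ν', hν'⟩)

end RewardMDP

/-! ### Stochastic approximation averages -/

section StepAverage

/-- The averages `P_{k+1} = (1 - λ_{k+1}) P_k + λ_{k+1} W_{k+1}`, `P_0 = 0`. -/
def stepAverage (lam W : ℕ → ℝ) : ℕ → ℝ
  | 0 => 0
  | k + 1 => (1 - lam (k + 1)) * stepAverage lam W k + lam (k + 1) * W (k + 1)

/-- The weight of `W j` in `stepAverage lam W k`. -/
def stepWeight (lam : ℕ → ℝ) : ℕ → ℕ → ℝ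
  | 0, _ => 0
  | k + 1, j => if j = k + 1 then lam (k + 1) else (1 - lam (k + 1)) * stepWeight lam k j

theorem stepAverage_eq_sum (lam W : ℕ → ℝ) (k : ℕ) :
    stepAverage lam W k = ∑ j ∈ Finset.range (k + 1), stepWeight lam k j * W j := by
  induction k with
  | zero => simp [stepAverage, stepWeight]
  | succ k ih =>
    rw [Finset.sum_range_succ, stepAverage, ih, Finset.mul_sum]
    congr 1
    · refine Finset.sum_congr rfl fun j hj => ?_
      have : j ≠ k + 1 := (Finset.mem_range.1 hj).ne
      rw [stepWeight, if_neg this, mul_assoc]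
    · rw [stepWeight, if_pos rfl]

theorem stepAverage_add (lam V W : ℕ → ℝ) (k : ℕ) :
    stepAverage lam (fun j => V j + W j) k = stepAverage lam V k + stepAverage lam W k := by
  simp only [stepAverage_eq_sum, mul_add, Finset.sum_add_distrib]

theorem stepAverage_const_mul (lam W : ℕ → ℝ) (c : ℝ) (k : ℕ) :
    stepAverage lam (fun j => c * W j) k = c * stepAverage lam W k := by
  simp only [stepAverage_eq_sum, Finset.mul_sum]
  exact Finset.sum_congr rfl fun j _ => by ring

theorem abs_stepAverage_le {lam W : ℕ → ℝ} {b : ℝ} (hb : 0 ≤ b) (h0 : ∀ k, 0 ≤ lam k)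
    (h1 : ∀ k, lam k ≤ 1) (k : ℕ) (hW : ∀ j, 1 ≤ j → j ≤ k → |W j| ≤ b) :
    |stepAverage lam W k| ≤ b := by
  induction k with
  | zero => simpa [stepAverage]
  | succ k ih =>
    rw [stepAverage]
    refine (abs_add_le _ _).trans ?_
    rw [abs_mul, abs_mul, abs_of_nonneg (sub_nonneg.2 (h1 (k + 1))), abs_of_nonneg (h0 (k + 1))]
    have h2 := mul_le_mul_of_nonneg_left (ih fun j hj hk => hW j hj (by omega))
      (sub_nonneg.2 (h1 (k + 1)))
    have h3 := mul_le_mul_of_nonneg_left (hW (k + 1) (by omega) le_rfl) (h0 (k + 1))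
    linarith

/-- The rescaled linear stepsize `1 / (1 + c k)`. -/
noncomputable def linStep (c : ℝ) (k : ℕ) : ℝ := 1 / (1 + c * (k : ℝ))

variable {c : ℝ}

theorem linStep_pos (hc : 0 ≤ c) (k : ℕ) : 0 < linStep c k := by
  unfold linStep; positivity

theorem linStep_le_one (hc : 0 ≤ c) (k : ℕ) : linStep c k ≤ 1 := by
  have : 0 ≤ c * (k : ℝ) := by positivity
  unfold linStep
  rw [div_le_one (by positivity)]
  linarith

/-- This is 1/λ_{k+1} = 1/λ_k + c: the stepsize is tuned so that a recursion with contraction factor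
1 - c λ_{k+1} is solved by λ_k itself. -/
theorem linStep_mul_one_sub (hc : 0 ≤ c) (k : ℕ) :
    linStep c k * (1 - c * linStep c (k + 1)) = linStep c (k + 1) := by
  have h : 0 ≤ c * (k : ℝ) := by positivity
  have h1 : 1 + c * (k : ℝ) ≠ 0 := by positivity
  have h2 : 1 + c * ((k : ℝ) + 1) ≠ 0 := by positivity
  unfold linStep
  push_cast
  field_simp
  ring

/-- This is the variance factor of an averaged noise. With y = λ_{k+1}, the induction is (1 - y)²
λ_k + y² ≤ (1 - y) y + y² = y. -/
theorem sum_sq_stepWeight_le (hc : 0 ≤ c) (hc1 : c ≤ 1) (k : ℕ) :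
    ∑ j ∈ Finset.range (k + 1), stepWeight (linStep c) k j ^ 2 ≤ linStep c k := by
  induction k with
  | zero => simp [stepWeight, linStep]
  | succ k ih =>
    rw [Finset.sum_range_succ]
    have h1 : ∑ j ∈ Finset.range (k + 1), stepWeight (linStep c) (k + 1) j ^ 2
        = (1 - linStep c (k + 1)) ^ 2
          * ∑ j ∈ Finset.range (k + 1), stepWeight (linStep c) k j ^ 2 := by
      rw [Finset.mul_sum]
      refine Finset.sum_congr rfl fun j hj => ?_
      have : j ≠ k + 1 := (Finset.mem_range.1 hj).ne
      rw [stepWeight, if_neg this, mul_pow]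
    rw [h1, stepWeight, if_pos rfl]
    set y := linStep c (k + 1) with hy
    have hy0 : 0 < y := linStep_pos hc _
    have hy1 : y ≤ 1 := linStep_le_one hc _
    have hx0 : 0 < linStep c k := linStep_pos hc _
    have hxy := linStep_mul_one_sub hc k
    rw [← hy] at hxy
    have h2 : (1 - y) * linStep c k ≤ y := by
      have : c * y ≤ 1 * y := mul_le_mul_of_nonneg_right hc1 hy0.le
      nlinarith
    have h3 : (1 - y) ^ 2 * ∑ j ∈ Finset.range (k + 1), stepWeight (linStep c) k j ^ 2
        ≤ (1 - y) * y := by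
      calc _ ≤ (1 - y) ^ 2 * linStep c k := mul_le_mul_of_nonneg_left ih (sq_nonneg _)
        _ = (1 - y) * ((1 - y) * linStep c k) := by ring
        _ ≤ _ := mul_le_mul_of_nonneg_left h2 (by linarith)
    nlinarith

/-- Accumulated noise levels √λ_i lose only a factor of order 1/c, because ∑ (1 + c i)^(-1/2) is
bounded by telescoping √(1 + c i). The constant 3 comes from √(a + c) ≤ 2 √a for c ≤ 1 ≤ a. -/
theorem sum_sqrt_linStep_le (hc : 0 < c) (hc1 : c ≤ 1) (k : ℕ) :
    linStep c k * ∑ i ∈ Finset.range k, Real.sqrt (linStep c i)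
      ≤ 3 / c * Real.sqrt (linStep c k) := by
  have hsum : ∀ k : ℕ, ∑ i ∈ Finset.range k, Real.sqrt (linStep c i)
      ≤ 3 / c * Real.sqrt (1 + c * k) := by
    intro k
    induction k with
    | zero => simp; positivity
    | succ k ih =>
      rw [Finset.sum_range_succ]
      have ha : 1 ≤ 1 + c * (k : ℝ) := by
        have : 0 ≤ c * (k : ℝ) := by positivity
        linarith
      set a := 1 + c * (k : ℝ) with hadef
      have hb : 1 + c * ((k + 1 : ℕ) : ℝ) = a + c := by push_cast; ring
      rw [hb]
      have hls : Real.sqrt (linStep c k) = 1 / Real.sqrt a := by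
        rw [linStep, ← hadef, Real.sqrt_div zero_le_one, Real.sqrt_one]
      have hsa : 0 < Real.sqrt a := Real.sqrt_pos.2 (by linarith)
      have hsa2 := Real.sq_sqrt (by linarith : 0 ≤ a)
      have hsb2 := Real.sq_sqrt (by linarith : 0 ≤ a + c)
      have hsb := Real.sqrt_nonneg (a + c)
      have h2 : Real.sqrt (a + c) ≤ 2 * Real.sqrt a := by
        rw [Real.sqrt_le_left (by positivity), mul_pow, hsa2]; linarith
      have h3 : 1 / Real.sqrt a ≤ 3 / c * (Real.sqrt (a + c) - Real.sqrt a) := by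
        rw [div_mul_eq_mul_div, div_le_div_iff₀ hsa hc]
        have h4 : (Real.sqrt (a + c) - Real.sqrt a) * (Real.sqrt (a + c) + Real.sqrt a) = c := by
          nlinarith
        have h5 : 0 ≤ Real.sqrt (a + c) - Real.sqrt a :=
          sub_nonneg.2 (Real.sqrt_le_sqrt (by linarith))
        nlinarith
      rw [hls]
      linarith
  have hp := linStep_pos hc.le k
  have h1 := mul_le_mul_of_nonneg_left (hsum k) hp.le
  refine h1.trans_eq ?_
  have h2 : 0 < 1 + c * (k : ℝ) := by positivity
  have h3 := Real.sq_sqrt h2.le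
  have h4 := Real.sqrt_pos.2 h2
  rw [linStep, Real.sqrt_div zero_le_one, Real.sqrt_one]
  field_simp
  exact h3

end StepAverage

/-! ### Empirical measures and concentration -/

section Concentration

variable {Y : Type*}

theorem empirical_nonneg {n : ℕ} (x : Fin n → Y) (y : Y) : 0 ≤ empirical x y := by
  unfold empirical; positivity

variable [Fintype Y]

theorem sum_empirical_mul {n : ℕ} (x : Fin n → Y) (f : Y → ℝ) :
    ∑ y, empirical x y * f y = (∑ i, f (x i)) / n := by
  classical
  have h : ∀ y, empirical x y * f y = (∑ i, if x i = y then f y else 0) / n := by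
    intro y
    rw [empirical, Nat.card_eq_fintype_card, Fintype.card_subtype, ← Finset.sum_filter,
      Finset.sum_const, nsmul_eq_mul]
    ring
  simp only [h]
  rw [← Finset.sum_div, Finset.sum_comm]
  simp

theorem sum_empirical {n : ℕ} (hn : 0 < n) (x : Fin n → Y) : ∑ y, empirical x y = 1 := by
  have h := sum_empirical_mul x fun _ => 1
  have hn' : (n : ℝ) ≠ 0 := by positivity
  simpa [hn'] using h

variable [MeasurableSpace Y] [MeasurableSingletonClass Y]
  {Ω : Type*} [MeasurableSpace Ω] {P : Measure Ω} [IsProbabilityMeasure P]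

/-- Hoeffding's inequality for weighted sums of centred empirical means. -/
theorem hoeffding_empirical {μ : PMF Y} {Z : ℕ → ℕ → Ω → Y}
    (hind : iIndepFun (fun j : ℕ × ℕ => Z j.1 j.2) P) (hm : ∀ k i, Measurable (Z k i))
    (hlaw : ∀ k i, P.map (Z k i) = μ.toMeasure) {f : Y → ℝ} {D σ θ : ℝ} (hD : 0 < D)
    (hf : ∀ y, |f y| ≤ D) (J : Finset ℕ) (a : ℕ → ℝ) (ha : ∑ j ∈ J, a j ^ 2 ≤ σ) (hσ : 0 < σ)
    {n : ℕ} (hn : 0 < n) (hθ : 0 ≤ θ) :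
    P.real {ω | θ ≤ |∑ j ∈ J, a j * ∑ y, (empirical (fun i : Fin n => Z j i ω) y - massOf μ y)
      * f y|} ≤ 2 * Real.exp (-(θ ^ 2 * n / (2 * D ^ 2 * σ))) := by
  have hn' : (0 : ℝ) < n := by exact_mod_cast hn
  have hfm : Measurable f := measurable_of_finite f
  set E := ∑ y, massOf μ y * f y with hE
  set X : ℕ × ℕ → Ω → ℝ := fun j ω => a j.1 / n * (f (Z j.1 j.2 ω) - E) with hX
  have hmean : ∀ k i, ∫ ω, f (Z k i ω) ∂P = E := fun k i => by
    rw [← integral_map (hm k i).aemeasurable hfm.aestronglyMeasurable, hlaw, PMF.integral_eq_sum]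
    rfl
  have hXind : iIndepFun X P :=
    hind.comp (fun j y => a j.1 / n * (f y - E)) fun j => measurable_of_finite _
  set c : ℕ × ℕ → NNReal := fun j => ⟨(a j.1 / n) ^ 2, sq_nonneg _⟩ * (‖D - -D‖₊ / 2) ^ 2 with hc
  have hsub : ∀ j, HasSubgaussianMGF (X j) (c j) P := fun j => by
    have h := hasSubgaussianMGF_of_mem_Icc (μ := P) (X := fun ω => f (Z j.1 j.2 ω)) (a := -D)
      (b := D) (hfm.comp (hm j.1 j.2)).aemeasurable
      (ae_of_all _ fun ω => abs_le.1 (hf (Z j.1 j.2 ω)))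
    rw [hmean] at h
    exact h.const_mul (a j.1 / n)
  have hsum := HasSubgaussianMGF.sum_of_iIndepFun hXind (s := J ×ˢ Finset.range n)
    fun j _ => hsub j
  have hcsum : ((∑ j ∈ J ×ˢ Finset.range n, c j : NNReal) : ℝ) ≤ D ^ 2 * σ / n := by
    have h1 : ∀ j, ((c j : NNReal) : ℝ) = (a j.1) ^ 2 * (D ^ 2 / n ^ 2) := fun j => by
      have h2 : ‖D - -D‖ = 2 * D := by
        rw [Real.norm_eq_abs, sub_neg_eq_add, abs_of_pos (by linarith)]; ring
      change (a j.1 / n) ^ 2 * (‖D - -D‖ / 2) ^ 2 = _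
      rw [h2]
      field_simp
    rw [NNReal.coe_sum]
    simp only [h1]
    rw [Finset.sum_product]
    simp only [Finset.sum_const, Finset.card_range, nsmul_eq_mul]
    rw [← Finset.mul_sum, ← Finset.sum_mul]
    calc (n : ℝ) * ((∑ j ∈ J, a j ^ 2) * (D ^ 2 / n ^ 2)) ≤ n * (σ * (D ^ 2 / n ^ 2)) := by gcongr
      _ = _ := by field_simp
  set c' : NNReal := ⟨D ^ 2 * σ / n, by positivity⟩ with hc'
  have hsum' : HasSubgaussianMGF (fun ω => ∑ j ∈ J ×ˢ Finset.range n, X j ω) c' P :=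
    ⟨hsum.integrable_exp_mul, fun s => (hsum.mgf_le s).trans (Real.exp_le_exp.2 (by
      have := mul_le_mul_of_nonneg_right hcsum (sq_nonneg s)
      change _ ≤ D ^ 2 * σ / n * s ^ 2 / 2
      linarith))⟩
  have hexp : -θ ^ 2 / (2 * (c' : ℝ)) = -(θ ^ 2 * n / (2 * D ^ 2 * σ)) := by
    change -θ ^ 2 / (2 * (D ^ 2 * σ / n)) = _
    field_simp
  have hup := hsum'.measure_ge_le hθ
  have hlo := hsum'.neg.measure_ge_le hθ
  rw [hexp] at hup hlo
  have heq : ∀ ω, ∑ j ∈ J, a j * ∑ y, (empirical (fun i : Fin n => Z j i ω) y - massOf μ y) * f y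
      = ∑ j ∈ J ×ˢ Finset.range n, X j ω := by
    intro ω
    rw [Finset.sum_product]
    refine Finset.sum_congr rfl fun j _ => ?_
    simp only [sub_mul, Finset.sum_sub_distrib, sum_empirical_mul, ← hE]
    rw [Fin.sum_univ_eq_sum_range (fun i => f (Z j i ω)) n]
    simp only [hX]
    rw [← Finset.mul_sum,
      Finset.sum_sub_distrib, Finset.sum_const, Finset.card_range, nsmul_eq_mul]
    field_simp
  simp only [heq]
  have hsubset : {ω | θ ≤ |∑ j ∈ J ×ˢ Finset.range n, X j ω|}
      ⊆ {ω | θ ≤ ∑ j ∈ J ×ˢ Finset.range n, X j ω}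
        ∪ {ω | θ ≤ (-fun ω => ∑ j ∈ J ×ˢ Finset.range n, X j ω) ω} := fun ω hω => by
    simp only [Set.mem_ofPred_eq] at hω
    rcases le_abs.1 hω with h | h
    · exact Or.inl h
    · exact Or.inr h
  refine (measureReal_mono hsubset).trans ((measureReal_union_le _ _).trans ?_)
  linarith

/-- Hoeffding for the indicator of y, with the threshold relative to the mass of y; this is where p²
enters. Atoms of mass zero are almost surely never sampled, so their deviation is zero. -/
theorem measureReal_empirical_dev_le {μ : PMF Y} {Z : ℕ → ℕ → Ω → Y}
    (hind : iIndepFun (fun j : ℕ × ℕ => Z j.1 j.2) P) (hm : ∀ k i, Measurable (Z k i))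
    (hlaw : ∀ k i, P.map (Z k i) = μ.toMeasure) {n : ℕ} (hn : 0 < n) {p t x : ℝ}
    (hp0 : 0 ≤ p) (hp : ∀ y, 0 < massOf μ y → p ≤ massOf μ y) (ht : 0 ≤ t)
    (hx : 2 * x ≤ t ^ 2 * p ^ 2 * n) (k : ℕ) (y : Y) :
    P.real {ω | t * massOf μ y < |empirical (fun i : Fin n => Z k i ω) y - massOf μ y|}
      ≤ 2 * Real.exp (-x) := by
  classical
  have hn' : (0 : ℝ) < n := by exact_mod_cast hn
  rcases (massOf_nonneg μ y).eq_or_lt with h0 | h0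
  · have hz : ∀ i : Fin n, P {ω | Z k i ω = y} = 0 := fun i => by
      have h1 : P {ω | Z k i ω = y} = P.map (Z k i) {y} := by
        rw [Measure.map_apply (hm k i) (measurableSet_singleton y)]; rfl
      rw [h1, hlaw, toMeasure_singleton, ← h0, ENNReal.ofReal_zero]
    have hsub : {ω | t * massOf μ y < |empirical (fun i : Fin n => Z k i ω) y - massOf μ y|}
        ⊆ ⋃ i : Fin n, {ω | Z k i ω = y} := fun ω hω => by
      by_contra hcon
      simp only [Set.mem_iUnion, Set.mem_ofPred_eq, not_exists] at hcon
      have : IsEmpty {i : Fin n // Z k i ω = y} := ⟨fun i => hcon i.1 i.2⟩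
      simp [empirical, ← h0] at hω
    have hnull := measure_mono_null hsub (measure_iUnion_null hz)
    rw [measureReal_def, hnull, ENNReal.toReal_zero]
    positivity
  · have h := hoeffding_empirical hind hm hlaw (f := fun z => if z = y then 1 else 0) (D := 1)
      (σ := 1) (θ := t * massOf μ y) one_pos (fun z => by split_ifs <;> simp) {k} (fun _ => 1)
      (by simp) one_pos hn (by positivity)
    simp only [Finset.sum_singleton, one_mul, mul_ite, mul_one, mul_zero, Finset.sum_ite_eq',
      Finset.mem_univ, if_true] at h
    refine (measureReal_mono fun ω hω => ?_).trans (h.trans ?_)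
    · simp only [Set.mem_ofPred_eq] at hω ⊢
      exact hω.le
    · refine mul_le_mul_of_nonneg_left (Real.exp_le_exp.2 (neg_le_neg ?_)) zero_le_two
      have h1 : p ^ 2 ≤ massOf μ y ^ 2 := pow_le_pow_left₀ hp0 (hp y h0) 2
      have h2 : t ^ 2 * p ^ 2 * n ≤ t ^ 2 * massOf μ y ^ 2 * n := by gcongr
      rw [mul_pow]
      linarith

/-- Outside a small event, the stepsize averages of the errors of the empirical dual values are
small. -/
theorem exists_bad_event {μ : PMF Y} {Z : ℕ → ℕ → Ω → Y}
    (hind : iIndepFun (fun j : ℕ × ℕ => Z j.1 j.2) P) (hm : ∀ k i, Measurable (Z k i))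
    (hlaw : ∀ k i, P.map (Z k i) = μ.toMeasure) {n : ℕ} (hn : 0 < n) {p t x δ H c : ℝ}
    {u : Y → ℝ} (hp : ∀ y, 0 < massOf μ y → p ≤ massOf μ y) (hδ : 0 < δ) (hδp : 47 * δ ≤ p)
    (hH : 0 < H) (hu0 : ∀ y, 0 ≤ u y) (huH : ∀ y, u y ≤ H) (ht0 : 0 ≤ t) (ht : t ≤ 1 / 100)
    (hx0 : 0 ≤ x) (hx : 2 * x ≤ t ^ 2 * p ^ 2 * n) (hc : 0 ≤ c) (hc1 : c ≤ 1) (k₀ : ℕ) :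
    ∃ bad : Set Ω, P.real bad ≤ k₀ * (2 * Fintype.card Y + 2) * Real.exp (-x) ∧
      ∀ ω ∉ bad, ∀ k ≤ k₀, |stepAverage (linStep c)
          (fun j => klDualSup (empirical fun i : Fin n => Z j i ω) u δ
            - klDualSup (massOf μ) u δ) k|
        ≤ H * (40 * t ^ 2 + 2 * Real.sqrt (2 * x / n) * Real.sqrt (linStep c k)) := by
  have hn' : (0 : ℝ) < n := by exact_mod_cast hn
  obtain ⟨-, L, -, -, -, -, hL, hexp⟩ := exists_klDualSup_expansion (massOf_nonneg μ)
    (massOf_sum μ) hp hδ hδp hu0 huH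
  set θ : ℕ → ℝ := fun k => H * (2 * Real.sqrt (2 * x / n) * Real.sqrt (linStep c k)) with hθ
  have hθ0 : ∀ k, 0 ≤ θ k := fun k => by positivity
  set lin : Ω → ℕ → ℝ := fun ω j =>
    ∑ y, (empirical (fun i : Fin n => Z j i ω) y - massOf μ y) * L y with hlin
  set dev : ℕ → Y → Set Ω := fun k y =>
    {ω | t * massOf μ y < |empirical (fun i : Fin n => Z k i ω) y - massOf μ y|} with hdev
  set big : ℕ → Set Ω := fun k => {ω | θ k ≤ |stepAverage (linStep c) (lin ω) k|} with hbig
  have hbigP : ∀ k, P.real (big k) ≤ 2 * Real.exp (-x) := fun k => by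
    have h := hoeffding_empirical hind hm hlaw (D := 2 * H) (by positivity) hL
      (Finset.range (k + 1)) _ (sum_sq_stepWeight_le hc hc1 k) (linStep_pos hc k) hn (hθ0 k)
    have he : θ k ^ 2 * n / (2 * (2 * H) ^ 2 * linStep c k) = x := by
      have h1 := linStep_pos hc k
      simp only [hθ, mul_pow]
      rw [Real.sq_sqrt (by positivity), Real.sq_sqrt h1.le]
      field_simp
    rw [he] at h
    simpa only [hbig, stepAverage_eq_sum, hlin] using h
  -- Indices start at 1 because `stepAverage` never reads the noise at index 0 and is 0 at k = 0.
  refine ⟨⋃ k ∈ Finset.Icc 1 k₀, ((⋃ y, dev k y) ∪ big k), ?_, fun ω hω k hk => ?_⟩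
  · refine (measureReal_biUnion_finset_le _ _).trans ?_
    have h1 : ∀ k ∈ Finset.Icc 1 k₀, P.real ((⋃ y, dev k y) ∪ big k)
        ≤ (2 * Fintype.card Y + 2) * Real.exp (-x) := fun k _ => by
      refine (measureReal_union_le _ _).trans ?_
      have h2 : P.real (⋃ y, dev k y) ≤ Fintype.card Y * (2 * Real.exp (-x)) := by
        refine (measureReal_iUnion_fintype_le _).trans ?_
        refine (Finset.sum_le_sum fun y _ =>
          measureReal_empirical_dev_le hind hm hlaw hn (by linarith) hp ht0 hx k y).trans_eq ?_
        rw [Finset.sum_const, Finset.card_univ, nsmul_eq_mul]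
      linarith [hbigP k]
    refine (Finset.sum_le_sum h1).trans_eq ?_
    rw [Finset.sum_const, Nat.card_Icc, nsmul_eq_mul]
    simp
    ring
  · simp only [Set.mem_iUnion, Set.mem_union, not_exists, not_or, Finset.mem_Icc] at hω
    have hgood : ∀ j, 1 ≤ j → j ≤ k → |klDualSup (empirical fun i : Fin n => Z j i ω) u δ
        - klDualSup (massOf μ) u δ - lin ω j| ≤ 40 * t ^ 2 * H := fun j hj hjk =>
      hexp _ t (empirical_nonneg _) (sum_empirical hn _) ht0 ht fun y =>
        not_lt.1 ((hω j ⟨hj, hjk.trans hk⟩).1 y)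
    have hsplit := stepAverage_add (linStep c) (lin ω)
      (fun j => klDualSup (empirical fun i : Fin n => Z j i ω) u δ
        - klDualSup (massOf μ) u δ - lin ω j) k
    simp only [add_sub_cancel] at hsplit
    rw [hsplit]
    have h1 := abs_stepAverage_le (by positivity) (fun k => (linStep_pos hc k).le)
      (linStep_le_one hc) k hgood
    have h2 : |stepAverage (linStep c) (lin ω) k| ≤ θ k := by
      rcases Nat.eq_zero_or_pos k with rfl | hk0
      · simpa [stepAverage] using hθ0 0
      · exact (not_le.1 (hω k ⟨hk0, hk⟩).2).le
    refine (abs_add_le _ _).trans ((add_le_add h2 h1).trans_eq ?_)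
    simp only [hθ]
    ring

end Concentration

/-! ### Deterministic analysis of the iteration -/

theorem abs_valueOf_sub_le {S A : Type*} [Fintype A] [Nonempty A] {q q' : S → A → ℝ} {b : ℝ}
    (h : ∀ s a, |q s a - q' s a| ≤ b) (s : S) : |valueOf q s - valueOf q' s| ≤ b := by
  have key : ∀ q q' : S → A → ℝ, (∀ s a, |q s a - q' s a| ≤ b) →
      valueOf q s ≤ valueOf q' s + b := fun q q' h => by
    refine Finset.sup'_le _ _ fun a ha => ?_
    have h1 := (abs_le.1 (h s a)).2
    have h2 : q' s a ≤ valueOf q' s := Finset.le_sup' (fun a => q' s a) ha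
    linarith
  have h1 := key q q' h
  have h2 := key q' q fun s a => by rw [abs_sub_comm]; exact h s a
  rw [abs_le]
  constructor <;> linarith

namespace RewardMDP

variable {S A : Type*} (M : RewardMDP S A)

theorem one_sub_γ_pos : 0 < 1 - M.γ := by linarith [M.γ_lt_one]

theorem one_le_horizon : 1 ≤ 1 / (1 - M.γ) := by
  rw [le_div_iff₀ M.one_sub_γ_pos]; linarith [M.γ_pos]

theorem one_add_γ_mul_horizon : 1 + M.γ * (1 / (1 - M.γ)) = 1 / (1 - M.γ) := by
  have := M.one_sub_γ_pos
  field_simp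
  ring

theorem stepsize_eq_linStep (k : ℕ) : M.stepsize k = linStep (1 - M.γ) k := rfl

variable [Fintype S] [Fintype A] [Nonempty A]

theorem abs_empBellman_sub_le {δ b : ℝ} (hδ : 0 ≤ δ) {n : ℕ} (hn : 0 < n)
    (x : S → A → Fin n → M.R × S) {q q' : S → A → ℝ} (h : ∀ s a, |q s a - q' s a| ≤ b)
    (s : S) (a : A) : |M.empBellman δ x q s a - M.empBellman δ x q' s a| ≤ M.γ * b := by
  unfold empBellman
  rw [add_sub_add_left_eq_sub, ← mul_sub, abs_mul, abs_of_pos M.γ_pos]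
  exact mul_le_mul_of_nonneg_left (abs_klDualSup_sub_le (empirical_nonneg _) (sum_empirical hn _)
    hδ (abs_valueOf_sub_le h)) M.γ_pos.le

theorem empBellman_mem_Icc {δ : ℝ} (hδ : 0 ≤ δ) (hR : ∀ r ∈ M.R, r ≤ 1) {n : ℕ} (hn : 0 < n)
    (x : S → A → Fin n → M.R × S) {q : S → A → ℝ}
    (h : ∀ s a, 0 ≤ q s a ∧ q s a ≤ 1 / (1 - M.γ)) (s : S) (a : A) :
    0 ≤ M.empBellman δ x q s a ∧ M.empBellman δ x q s a ≤ 1 / (1 - M.γ) := by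
  have hv0 : ∀ s, 0 ≤ valueOf q s := fun s => by
    obtain ⟨a⟩ := ‹Nonempty A›
    exact (h s a).1.trans (Finset.le_sup' (fun a => q s a) (Finset.mem_univ a))
  have hv1 : ∀ s, valueOf q s ≤ 1 / (1 - M.γ) := fun s =>
    Finset.sup'_le _ _ fun a _ => (h s a).2
  have r0 : 0 ≤ klDualSup (empirical fun i => (x s a i).1) (fun r : M.R => (r : ℝ)) δ :=
    const_le_klDualSup (empirical_nonneg _) (sum_empirical hn _) hδ fun r _ => M.R_nonneg r r.2
  have r1 : klDualSup (empirical fun i => (x s a i).1) (fun r : M.R => (r : ℝ)) δ ≤ 1 :=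
    klDualSup_le_const (empirical_nonneg _) (sum_empirical hn _) hδ fun r _ => hR r r.2
  have s0 : 0 ≤ klDualSup (empirical fun i => (x s a i).2) (valueOf q) δ :=
    const_le_klDualSup (empirical_nonneg _) (sum_empirical hn _) hδ fun s _ => hv0 s
  have s1 : klDualSup (empirical fun i => (x s a i).2) (valueOf q) δ ≤ 1 / (1 - M.γ) :=
    klDualSup_le_const (empirical_nonneg _) (sum_empirical hn _) hδ fun s _ => hv1 s
  have g0 := mul_nonneg M.γ_pos.le s0
  have g1 := mul_le_mul_of_nonneg_left s1 M.γ_pos.le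
  have hg := M.one_add_γ_mul_horizon
  unfold empBellman
  constructor <;> linarith

theorem drQ_mem_Icc {δ : ℝ} (hδ : 0 ≤ δ) (hR : ∀ r ∈ M.R, r ≤ 1) {n : ℕ} (hn : 0 < n)
    (x : ℕ → S → A → ℕ → M.R × S) (k : ℕ) (s : S) (a : A) :
    0 ≤ M.drQ δ n x k s a ∧ M.drQ δ n x k s a ≤ 1 / (1 - M.γ) := by
  induction k generalizing s a with
  | zero => exact ⟨le_rfl, zero_le_one.trans M.one_le_horizon⟩
  | succ k ih =>
    have hT := M.empBellman_mem_Icc hδ hR hn (fun s a (i : Fin n) => x (k + 1) s a i) ih s a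
    have hl0 := (linStep_pos M.one_sub_γ_pos.le (k + 1)).le
    have hl1 := sub_nonneg.2 (linStep_le_one M.one_sub_γ_pos.le (k + 1))
    rw [drQ, stepsize_eq_linStep]
    constructor
    · have h1 := mul_nonneg hl1 (ih s a).1
      have h2 := mul_nonneg hl0 hT.1
      linarith
    · have h1 := mul_le_mul_of_nonneg_left (ih s a).2 hl1
      have h2 := mul_le_mul_of_nonneg_left hT.2 hl0
      linarith

/-- The iterates differ from `q` by the averaged noise `stepAverage` and a remainder that is
controlled by the accumulated sizes of these averages. -/
theorem abs_drQ_sub_le {δ H : ℝ} (hδ : 0 ≤ δ) {n : ℕ} (hn : 0 < n)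
    (x : ℕ → S → A → ℕ → M.R × S) {q : S → A → ℝ} (hq : ∀ s a, |q s a| ≤ H) {e : ℕ → ℝ} {k₀ : ℕ}
    (he : ∀ k ≤ k₀, ∀ s a, |stepAverage (linStep (1 - M.γ)) (fun j =>
      M.empBellman δ (fun s a (i : Fin n) => x j s a i) q s a - q s a) k| ≤ e k)
    (s : S) (a : A) :
    |M.drQ δ n x k₀ s a - q s a|
      ≤ linStep (1 - M.γ) k₀ * (H + ∑ i ∈ Finset.range k₀, e i) + e k₀ := by
  set c := 1 - M.γ with hc
  have hc0 : 0 < c := M.one_sub_γ_pos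
  set W : S → A → ℕ → ℝ := fun s a j =>
    M.empBellman δ (fun s a (i : Fin n) => x j s a i) q s a - q s a with hW
  -- After subtracting the averaged noise, only differences of the same empirical operator remain.
  -- The factor (1 - λ) + λγ = 1 - cλ acts on the old remainder, and γ e_k ≤ e_k enters as a new
  -- term.
  have key : ∀ k ≤ k₀, ∀ s a, |M.drQ δ n x k s a - q s a - stepAverage (linStep c) (W s a) k|
      ≤ linStep c k * (H + ∑ i ∈ Finset.range k, e i) := by
    intro k
    induction k with
    | zero => intro _ s a; simpa [drQ, stepAverage, linStep] using hq s a
    | succ k ih =>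
      intro hk s a
      have ih' := ih (by omega)
      have hek : ∀ s a, |stepAverage (linStep c) (W s a) k| ≤ e k := he k (by omega)
      have hdist : ∀ s a, |M.drQ δ n x k s a - q s a|
          ≤ linStep c k * (H + ∑ i ∈ Finset.range k, e i) + e k := fun s a => by
        have := abs_add_le (M.drQ δ n x k s a - q s a - stepAverage (linStep c) (W s a) k)
          (stepAverage (linStep c) (W s a) k)
        rw [sub_add_cancel] at this
        linarith [ih' s a, hek s a]
      have hT := M.abs_empBellman_sub_le hδ hn (fun s a (i : Fin n) => x (k + 1) s a i) hdist s a
      have hl0 := (linStep_pos hc0.le (k + 1)).le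
      have hl1 := sub_nonneg.2 (linStep_le_one hc0.le (k + 1))
      have hrec : M.drQ δ n x (k + 1) s a - q s a - stepAverage (linStep c) (W s a) (k + 1)
          = (1 - linStep c (k + 1))
              * (M.drQ δ n x k s a - q s a - stepAverage (linStep c) (W s a) k)
            + linStep c (k + 1)
              * (M.empBellman δ (fun s a (i : Fin n) => x (k + 1) s a i) (M.drQ δ n x k) s a
                - M.empBellman δ (fun s a (i : Fin n) => x (k + 1) s a i) q s a) := by
        rw [drQ, stepAverage, stepsize_eq_linStep, ← hc]
        simp only [hW]
        ring
      rw [hrec]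
      refine (abs_add_le _ _).trans ?_
      rw [abs_mul, abs_mul, abs_of_nonneg hl1, abs_of_nonneg hl0]
      have h1 := mul_le_mul_of_nonneg_left (ih' s a) hl1
      have h2 := mul_le_mul_of_nonneg_left hT hl0
      have h3 : M.γ = 1 - c := by rw [hc]; ring
      have he0 : 0 ≤ e k := (abs_nonneg _).trans (hek s a)
      have h4 : linStep c (k + 1) * (M.γ * e k) ≤ linStep c (k + 1) * e k :=
        mul_le_mul_of_nonneg_left (by nlinarith [M.γ_lt_one]) hl0
      have h5 := linStep_mul_one_sub hc0.le k
      rw [Finset.sum_range_succ]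
      set G := H + ∑ i ∈ Finset.range k, e i with hG
      have h6 : (1 - linStep c (k + 1)) * (linStep c k * G)
          + linStep c (k + 1) * (M.γ * (linStep c k * G)) = linStep c (k + 1) * G := by
        rw [h3]
        linear_combination G * h5
      rw [← add_assoc, ← hG]
      linarith
  have h1 := abs_add_le (M.drQ δ n x k₀ s a - q s a - stepAverage (linStep c) (W s a) k₀)
    (stepAverage (linStep c) (W s a) k₀)
  rw [sub_add_cancel] at h1
  linarith [key k₀ le_rfl s a, he k₀ le_rfl s a]

/-! ### The noise of the iteration -/

variable [MeasurableSpace S] [MeasurableSingletonClass S]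

theorem qStar_eq_klDualSup {δ : ℝ} (hδ : 0 < δ) (hδp : 47 * δ ≤ M.pMin)
    (hR : ∀ r ∈ M.R, r ≤ 1) (s : S) (a : A) :
    M.qStar δ s a = klDualSup (massOf (M.ν s a)) (fun r : M.R => (r : ℝ)) δ
      + M.γ * klDualSup (massOf (M.p s a)) (M.vStar δ) δ :=
  M.robustBackup_eq_klDualSup hδ hδp hR (fun s => (M.vStar_mem_Icc δ hR s).1)
    (fun s => (M.vStar_mem_Icc δ hR s).2) s a

theorem qStar_mem_Icc {δ : ℝ} (hδ : 0 < δ) (hδp : 47 * δ ≤ M.pMin)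
    (hR : ∀ r ∈ M.R, r ≤ 1) (s : S) (a : A) :
    0 ≤ M.qStar δ s a ∧ M.qStar δ s a ≤ 1 / (1 - M.γ) := by
  have r0 : 0 ≤ klDualSup (massOf (M.ν s a)) (fun r : M.R => (r : ℝ)) δ :=
    const_le_klDualSup (massOf_nonneg _) (massOf_sum _) hδ.le fun r _ => M.R_nonneg r r.2
  have r1 : klDualSup (massOf (M.ν s a)) (fun r : M.R => (r : ℝ)) δ ≤ 1 :=
    klDualSup_le_const (massOf_nonneg _) (massOf_sum _) hδ.le fun r _ => hR r r.2
  have s0 : 0 ≤ klDualSup (massOf (M.p s a)) (M.vStar δ) δ :=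
    const_le_klDualSup (massOf_nonneg _) (massOf_sum _) hδ.le
      fun s _ => (M.vStar_mem_Icc δ hR s).1
  have s1 : klDualSup (massOf (M.p s a)) (M.vStar δ) δ ≤ 1 / (1 - M.γ) :=
    klDualSup_le_const (massOf_nonneg _) (massOf_sum _) hδ.le
      fun s _ => (M.vStar_mem_Icc δ hR s).2
  have g0 := mul_nonneg M.γ_pos.le s0
  have g1 := mul_le_mul_of_nonneg_left s1 M.γ_pos.le
  have hg := M.one_add_γ_mul_horizon
  rw [M.qStar_eq_klDualSup hδ hδp hR]
  constructor <;> linarith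

variable {M} {Ω : Type*} [MeasurableSpace Ω] {P : Measure Ω} [IsProbabilityMeasure P]
  {X : ℕ → S → A → ℕ → Ω → M.R × S}

/-- Outside a small event, the averaged noise of the iteration at `(s, a)` is small. -/
theorem IsSimulator.exists_bad_event_at (hX : M.IsSimulator P X) {δ t x : ℝ} (hδ : 0 < δ)
    (hδp : 47 * δ ≤ M.pMin) (hR : ∀ r ∈ M.R, r ≤ 1) {n : ℕ} (hn : 0 < n) (ht0 : 0 ≤ t)
    (ht : t ≤ 1 / 100) (hx0 : 0 ≤ x) (hx : 2 * x ≤ t ^ 2 * M.pMin ^ 2 * n) (k₀ : ℕ)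
    (s : S) (a : A) :
    ∃ bad : Set Ω, P.real bad ≤ k₀ * (2 * M.R.card + 2 * Fintype.card S + 4) * Real.exp (-x) ∧
      ∀ ω ∉ bad, ∀ k ≤ k₀, |stepAverage (linStep (1 - M.γ)) (fun j =>
        M.empBellman δ (fun s a (i : Fin n) => X j s a i ω) (M.qStar δ) s a
          - M.qStar δ s a) k|
        ≤ 1 / (1 - M.γ) * (40 * t ^ 2 + 2 * Real.sqrt (2 * x / n)
          * Real.sqrt (linStep (1 - M.γ) k)) := by
  have hc0 := M.one_sub_γ_pos
  have hc1 : 1 - M.γ ≤ 1 := by linarith [M.γ_pos]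
  have hind : iIndepFun (fun j : ℕ × ℕ => X j.1 s a j.2) P :=
    hX.indep.precomp (g := fun j : ℕ × ℕ => (j.1, s, a, j.2)) fun i j h => by
      simp only [Prod.mk.injEq, true_and] at h
      exact Prod.ext h.1 h.2
  have hmf : ∀ k i, Measurable fun ω => (X k s a i ω).1 := fun k i =>
    measurable_fst.comp (hX.measurable k s a i)
  have hms : ∀ k i, Measurable fun ω => (X k s a i ω).2 := fun k i =>
    measurable_snd.comp (hX.measurable k s a i)
  have hlf : ∀ k i, P.map (fun ω => (X k s a i ω).1) = (M.ν s a).toMeasure := fun k i => by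
    have h := Measure.map_map (μ := P) measurable_fst (hX.measurable k s a i)
    rw [hX.law, Measure.map_fst_prod, measure_univ, one_smul] at h
    exact h.symm
  have hls : ∀ k i, P.map (fun ω => (X k s a i ω).2) = (M.p s a).toMeasure := fun k i => by
    have h := Measure.map_map (μ := P) measurable_snd (hX.measurable k s a i)
    rw [hX.law, Measure.map_snd_prod, measure_univ, one_smul] at h
    exact h.symm
  obtain ⟨badR, hPR, hbR⟩ := exists_bad_event (Z := fun k i ω => (X k s a i ω).1)
    (hind.comp (fun _ => Prod.fst) fun _ => measurable_fst) hmf hlf hn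
    (u := fun r : M.R => (r : ℝ)) (M.pMin_le_massOf s a).1 hδ hδp one_pos
    (fun r => M.R_nonneg r r.2) (fun r => hR r r.2) ht0 ht hx0 hx hc0.le hc1 k₀
  obtain ⟨badS, hPS, hbS⟩ := exists_bad_event (Z := fun k i ω => (X k s a i ω).2)
    (hind.comp (fun _ => Prod.snd) fun _ => measurable_snd) hms hls hn
    (u := M.vStar δ) (M.pMin_le_massOf s a).2 hδ hδp (one_div_pos.2 hc0)
    (fun s => (M.vStar_mem_Icc δ hR s).1) (fun s => (M.vStar_mem_Icc δ hR s).2)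
    ht0 ht hx0 hx hc0.le hc1 k₀
  refine ⟨badR ∪ badS, ?_, fun ω hω k hk => ?_⟩
  · rw [Fintype.card_coe] at hPR
    refine (measureReal_union_le _ _).trans ((add_le_add hPR hPS).trans_eq ?_)
    ring
  · rw [Set.mem_union, not_or] at hω
    have h1 := hbR ω hω.1 k hk
    have h2 := mul_le_mul_of_nonneg_left (hbS ω hω.2 k hk) M.γ_pos.le
    have hsplit : (fun j => M.empBellman δ (fun s a (i : Fin n) => X j s a i ω) (M.qStar δ) s a
          - M.qStar δ s a)
        = fun j => (klDualSup (empirical fun i : Fin n => (X j s a i ω).1)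
              (fun r : M.R => (r : ℝ)) δ
            - klDualSup (massOf (M.ν s a)) (fun r : M.R => (r : ℝ)) δ)
          + M.γ * (klDualSup (empirical fun i : Fin n => (X j s a i ω).2) (M.vStar δ) δ
            - klDualSup (massOf (M.p s a)) (M.vStar δ) δ) := by
      funext j
      rw [M.qStar_eq_klDualSup hδ hδp hR, empBellman, M.valueOf_qStar]
      ring
    rw [hsplit, stepAverage_add, stepAverage_const_mul]
    refine (abs_add_le _ _).trans ?_
    rw [abs_mul, abs_of_pos M.γ_pos]
    refine (add_le_add h1 h2).trans_eq ?_
    rw [← mul_assoc, ← add_mul, M.one_add_γ_mul_horizon]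

end RewardMDP

/-! ### Error budget, union bound and conclusion -/

/-- The stepsizes and batch sizes of the theorem make the total error at most `ε`. -/
theorem total_error_le {c ε p l t n : ℝ} {k : ℕ} (hc0 : 0 < c) (hc1 : c ≤ 1) (hε : 0 < ε)
    (hp0 : 0 < p) (hp1 : p ≤ 1) (hl : 1 ≤ l) (hk0 : 0 < k) (hk : 4 * (1 / (c ^ 3 * ε)) ≤ k)
    (hn0 : 0 < n) (hn : 40000 * (l ^ 2 / (p ^ 3 * c ^ 2 * ε)) ≤ n)
    (ht : t ^ 2 * p ^ 2 * n = 4 * l) :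
    t ^ 2 ≤ c ^ 2 * ε / 10000 ∧
    linStep c k * (1 / c + ∑ i ∈ Finset.range k,
        1 / c * (40 * t ^ 2 + 2 * Real.sqrt (4 * l / n) * Real.sqrt (linStep c i)))
      + 1 / c * (40 * t ^ 2 + 2 * Real.sqrt (4 * l / n) * Real.sqrt (linStep c k)) ≤ ε := by
  have hk' : (0 : ℝ) < k := by exact_mod_cast hk0
  have hk1 : 4 ≤ k * (c ^ 3 * ε) := by
    rwa [mul_one_div, div_le_iff₀ (by positivity)] at hk
  have hn1 : 40000 * l ^ 2 ≤ n * (p ^ 3 * c ^ 2 * ε) := by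
    rwa [← mul_div_assoc, div_le_iff₀ (by positivity)] at hn
  have hn2 : 40000 * l ≤ n * (p ^ 2 * c ^ 2 * ε) := by
    have h1 : n * (p ^ 3 * c ^ 2 * ε) ≤ n * (p ^ 2 * c ^ 2 * ε) := by
      have : p ^ 3 ≤ p ^ 2 := pow_le_pow_of_le_one hp0.le hp1 (by norm_num)
      gcongr
    nlinarith
  have ht2 : t ^ 2 ≤ c ^ 2 * ε / 10000 := by
    have h1 : t ^ 2 * (p ^ 2 * n) ≤ c ^ 2 * ε / 10000 * (p ^ 2 * n) := by linarith
    exact le_of_mul_le_mul_right h1 (by positivity)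
  have hA : 4 * l / n ≤ c ^ 2 * ε / 10000 := by
    rw [div_le_iff₀ hn0]
    have h1 : n * (p ^ 2 * c ^ 2 * ε) ≤ n * (1 * c ^ 2 * ε) := by
      have : p ^ 2 ≤ 1 := pow_le_one₀ hp0.le hp1
      gcongr
    linarith
  have hlam0 := linStep_pos hc0.le k
  have hlamk : linStep c k * (c * k) ≤ 1 := by
    have : 0 < c * (k : ℝ) := by positivity
    rw [linStep, one_div_mul_eq_div, div_le_one (by positivity)]
    linarith
  have hlam : linStep c k ≤ c ^ 2 * ε / 4 := by
    have h1 : linStep c k * 4 ≤ linStep c k * (k * (c ^ 3 * ε)) :=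
      mul_le_mul_of_nonneg_left hk1 hlam0.le
    have h2 : linStep c k * (c * k) * (c ^ 2 * ε) ≤ 1 * (c ^ 2 * ε) :=
      mul_le_mul_of_nonneg_right hlamk (by positivity)
    linarith
  set σ := Real.sqrt (4 * l / n) with hσ
  have hσ0 : 0 ≤ σ := Real.sqrt_nonneg _
  have hσlam : σ * Real.sqrt (linStep c k) ≤ c ^ 2 * ε / 200 := by
    rw [hσ, ← Real.sqrt_mul (by positivity), Real.sqrt_le_left (by positivity)]
    calc 4 * l / n * linStep c k ≤ c ^ 2 * ε / 10000 * (c ^ 2 * ε / 4) :=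
          mul_le_mul hA hlam hlam0.le (by positivity)
      _ = _ := by ring
  refine ⟨ht2, ?_⟩
  have hS := sum_sqrt_linStep_le hc0 hc1 k
  set S := ∑ i ∈ Finset.range k, Real.sqrt (linStep c i) with hSdef
  have hsum : ∑ i ∈ Finset.range k, 1 / c * (40 * t ^ 2 + 2 * σ * Real.sqrt (linStep c i))
      = 1 / c * (k * (40 * t ^ 2) + 2 * σ * S) := by
    rw [← Finset.mul_sum, Finset.sum_add_distrib, Finset.sum_const, Finset.card_range,
      nsmul_eq_mul, hSdef, Finset.mul_sum]
  have hS' : σ * (linStep c k * S) * c ≤ 3 * (c ^ 2 * ε / 200) := by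
    have h1 := mul_le_mul_of_nonneg_left hS hσ0
    have h2 : σ * (3 / c * Real.sqrt (linStep c k)) * c = 3 * (σ * Real.sqrt (linStep c k)) := by
      field_simp
    have h3 := mul_le_mul_of_nonneg_right h1 hc0.le
    linarith
  have hkt : linStep c k * (c * k) * (40 * t ^ 2) ≤ 1 * (40 * t ^ 2) :=
    mul_le_mul_of_nonneg_right hlamk (by positivity)
  rw [hsum]
  -- In units of c²ε, the initial error costs 1/4, the two quadratic biases 40/10000 each, the
  -- accumulated noise 6/200 and the last noise 2/200.
  have hfin : c ^ 2 * (linStep c k * (1 / c + 1 / c * (k * (40 * t ^ 2) + 2 * σ * S))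
      + 1 / c * (40 * t ^ 2 + 2 * σ * Real.sqrt (linStep c k))) ≤ c ^ 2 * ε := by
    have h1 : c ^ 2 * (linStep c k * (1 / c + 1 / c * (k * (40 * t ^ 2) + 2 * σ * S))
        + 1 / c * (40 * t ^ 2 + 2 * σ * Real.sqrt (linStep c k)))
        = c * linStep c k + linStep c k * (c * k) * (40 * t ^ 2) + 2 * (σ * (linStep c k * S) * c)
          + c * (40 * t ^ 2) + 2 * c * (σ * Real.sqrt (linStep c k)) := by
      field_simp
      ring
    have h2 : c * linStep c k ≤ 1 * (c ^ 2 * ε / 4) := mul_le_mul hc1 hlam hlam0.le zero_le_one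
    have h3 : c * (40 * t ^ 2) ≤ 1 * (40 * t ^ 2) :=
      mul_le_mul_of_nonneg_right hc1 (by positivity)
    have h4 : c * (σ * Real.sqrt (linStep c k)) ≤ 1 * (c ^ 2 * ε / 200) :=
      mul_le_mul hc1 hσlam (by positivity) zero_le_one
    have h5 : 0 < c ^ 2 * ε := by positivity
    rw [h1]
    linarith
  exact le_of_mul_le_mul_left hfin (by positivity)

theorem one_le_log_of_four_le {x : ℝ} (hx : 4 ≤ x) : 1 ≤ Real.log x := by
  rw [Real.le_log_iff_exp_le (by linarith)]
  linarith [Real.exp_one_lt_d9]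

namespace RewardMDP

variable {S A : Type*} [Fintype S] [Nonempty S] [Fintype A] [Nonempty A] (M : RewardMDP S A)

theorem one_le_dimConst : 1 ≤ M.dimConst := by
  have h1 : (1 : ℝ) ≤ Fintype.card S := by exact_mod_cast Fintype.card_pos
  have h2 : (1 : ℝ) ≤ Fintype.card A := by exact_mod_cast Fintype.card_pos
  have h3 : (1 : ℝ) ≤ max (Fintype.card S : ℝ) (M.R.card : ℝ) := h1.trans (le_max_left _ _)
  exact one_le_mul_of_one_le_of_one_le (one_le_mul_of_one_le_of_one_le h1 h2) h3

/-- At most 8dk terms are summed. Exponent l would give only 2η; exponent 2l squares η/(4dk) and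
leaves η²/(2dk). -/
theorem union_bound_le {η : ℝ} {k : ℕ} (hη0 : 0 < η) (hη1 : η < 1) (hk : 0 < k) :
    (Fintype.card S : ℝ) * ((Fintype.card A : ℝ) * (k * (2 * M.R.card + 2 * Fintype.card S + 4)
      * Real.exp (-(2 * Real.log (4 * M.dimConst * k / η))))) ≤ η := by
  have hk' : (1 : ℝ) ≤ k := by exact_mod_cast hk
  have hd := M.one_le_dimConst
  have hz : 0 < 4 * M.dimConst * k / η := by positivity
  have hexp : Real.exp (-(2 * Real.log (4 * M.dimConst * k / η)))
      = (η / (4 * M.dimConst * k)) ^ 2 := by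
    rw [Real.exp_neg, two_mul, Real.exp_add, Real.exp_log hz, ← sq, ← inv_pow, inv_div]
  have h1 : (1 : ℝ) ≤ Fintype.card S := by exact_mod_cast Fintype.card_pos
  have hm : 2 * (M.R.card : ℝ) + 2 * Fintype.card S + 4
      ≤ 8 * max (Fintype.card S : ℝ) (M.R.card : ℝ) := by
    have h2 := le_max_left (Fintype.card S : ℝ) (M.R.card : ℝ)
    have h3 := le_max_right (Fintype.card S : ℝ) (M.R.card : ℝ)
    linarith
  rw [hexp]
  calc _ ≤ (Fintype.card S : ℝ) * ((Fintype.card A : ℝ)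
        * (k * (8 * max (Fintype.card S : ℝ) (M.R.card : ℝ))
          * (η / (4 * M.dimConst * k)) ^ 2)) := by gcongr
    _ = 8 * M.dimConst * k * (η / (4 * M.dimConst * k)) ^ 2 := by
        rw [dimConst]; ring
    _ = η * (η / (2 * (M.dimConst * k))) := by field_simp; ring
    _ ≤ η * 1 := by
        refine mul_le_mul_of_nonneg_left ?_ hη0.le
        rw [div_le_one (by positivity)]
        have := one_le_mul_of_one_le_of_one_le hd hk'
        linarith
    _ = η := mul_one η

end RewardMDP

theorem norm_sub_le_of_forall {S A : Type*} [Fintype S] [Fintype A] {q q' : S → A → ℝ} {ε : ℝ}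
    (hε : 0 ≤ ε) (h : ∀ s a, |q s a - q' s a| ≤ ε) : ‖q - q'‖ ≤ ε :=
  (pi_norm_le_iff_of_nonneg hε).2 fun s => (pi_norm_le_iff_of_nonneg hε).2 fun a => h s a

theorem mainTheorem6 :
    ∃ c₁ c₂ : ℝ, 0 < c₁ ∧ 0 < c₂ ∧
      ∀ (S A : Type*) [Fintype S] [Nonempty S] [Fintype A] [Nonempty A]
        [MeasurableSpace S] [MeasurableSingletonClass S]
        (M : RewardMDP S A) (δ ε η : ℝ),
        0 < δ → δ < -Real.log (1 - 1 / 48 * M.pMin) →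
        (∀ r ∈ M.R, r ≤ 1) →
        0 < ε → 0 < η → η < 1 →
        ∀ (Ω : Type*) [MeasurableSpace Ω] (P : Measure Ω) [IsProbabilityMeasure P]
          (X : ℕ → S → A → ℕ → Ω → M.R × S), M.IsSimulator P X →
          ∀ k₀ n₀ : ℕ, k₀ = M.numIter c₁ ε η → n₀ = M.batchSize c₂ ε η k₀ →
            1 - η ≤ P.real {ω | ‖M.drQ δ n₀ (fun k s a i => X k s a i ω) k₀
              - M.qStar δ‖ ≤ ε} := by
  refine ⟨4, 40000, by norm_num, by norm_num, ?_⟩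
  intro S A _ _ _ _ _ _ M δ ε η hδ hδlog hR hε hη0 hη1 Ω _ P _ X hX k₀ n₀ hk₀ hn₀
  have hp0 := RewardMDP.pMin_pos_of_lt hδ hδlog
  have hp1 := M.pMin_le_one
  have hδp := RewardMDP.delta_le_of_lt_log hp0 hp1 hδlog
  have hc0 := M.one_sub_γ_pos
  have hc1 : 1 - M.γ ≤ 1 := by linarith [M.γ_pos]
  have hd := M.one_le_dimConst
  have hq := M.qStar_mem_Icc hδ hδp hR
  have hL : 0 < k₀ → 1 ≤ Real.log (4 * M.dimConst * k₀ / η) := fun hk => by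
    have hk' : (1 : ℝ) ≤ k₀ := by exact_mod_cast hk
    refine one_le_log_of_four_le ?_
    rw [le_div_iff₀ hη0]
    have := one_le_mul_of_one_le_of_one_le hd hk'
    linarith
  have hnpos : 0 < k₀ → 0 < n₀ := fun hk => by
    have := hL hk
    rw [hn₀, RewardMDP.batchSize, Nat.ceil_pos]
    positivity
  -- If ε exceeds the horizon, the range [0, 1/(1-γ)] of both functions already gives the claim.
  -- This also covers k₀ = 0, where the batch size may be 0.
  rcases le_or_gt (1 / (1 - M.γ)) ε with hbig | hsmall
  · have hall : ∀ ω, ‖M.drQ δ n₀ (fun k s a i => X k s a i ω) k₀ - M.qStar δ‖ ≤ ε := fun ω => by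
      refine norm_sub_le_of_forall hε.le fun s a => (abs_le.2 ?_)
      have h1 : 0 ≤ M.drQ δ n₀ (fun k s a i => X k s a i ω) k₀ s a
          ∧ M.drQ δ n₀ (fun k s a i => X k s a i ω) k₀ s a ≤ 1 / (1 - M.γ) := by
        rcases Nat.eq_zero_or_pos k₀ with h0 | h0
        · rw [h0]
          exact ⟨le_rfl, zero_le_one.trans M.one_le_horizon⟩
        · exact M.drQ_mem_Icc hδ.le hR (hnpos h0) _ k₀ s a
      have h2 := hq s a
      constructor <;> linarith
    simp only [hall, Set.ofPred_true, probReal_univ]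
    linarith
  · have hεc : ε * (1 - M.γ) < 1 := by rwa [lt_div_iff₀ hc0] at hsmall
    have hlog : 1 ≤ Real.log (4 * M.dimConst / ((1 - M.γ) * η * ε)) := by
      refine one_le_log_of_four_le ?_
      rw [le_div_iff₀ (by positivity)]
      have : ε * (1 - M.γ) * η ≤ 1 := mul_le_one₀ hεc.le hη0.le hη1.le
      linarith
    have hkreal : 4 * (1 / ((1 - M.γ) ^ 3 * ε)) ≤ (k₀ : ℝ) := by
      rw [hk₀]
      refine le_trans ?_ (Nat.le_ceil _)
      -- The cubed logarithm is used only through being at least 1.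
      exact le_mul_of_one_le_right (by positivity) (one_le_pow₀ hlog)
    have hkpos : 0 < k₀ := by
      have : (0 : ℝ) < k₀ := lt_of_lt_of_le (by positivity) hkreal
      exact_mod_cast this
    have hn := hnpos hkpos
    have hn' : (0 : ℝ) < n₀ := by exact_mod_cast hn
    have hl := hL hkpos
    set l := Real.log (4 * M.dimConst * k₀ / η) with hldef
    have hnreal : 40000 * (l ^ 2 / (M.pMin ^ 3 * (1 - M.γ) ^ 2 * ε)) ≤ (n₀ : ℝ) := by
      rw [hn₀]
      exact Nat.le_ceil _
    -- The relative deviation at which the Hoeffding exponent t² p_∧² n₀ / 2 equals the 2l needed by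
    -- the union bound.
    obtain ⟨t, ht⟩ : ∃ t : ℝ, t = Real.sqrt (4 * l / (n₀ * M.pMin ^ 2)) := ⟨_, rfl⟩
    have ht0 : 0 ≤ t := ht ▸ Real.sqrt_nonneg _
    have htsq : t ^ 2 * M.pMin ^ 2 * n₀ = 4 * l := by
      rw [ht, Real.sq_sqrt (by positivity)]
      field_simp
    obtain ⟨ht2, herr⟩ := total_error_le hc0 hc1 hε hp0 hp1 hl hkpos hkreal hn' hnreal htsq
    have ht1 : t ≤ 1 / 100 := by
      refine abs_le_of_sq_le_sq' ?_ (by norm_num) |>.2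
      have : (1 - M.γ) * (ε * (1 - M.γ)) ≤ 1 * 1 :=
        mul_le_mul hc1 hεc.le (by positivity) zero_le_one
      linarith
    choose bad hbadP hbad using fun s a => hX.exists_bad_event_at hδ hδp hR hn ht0 ht1
      (x := 2 * l) (by positivity) (by linarith) k₀ s a
    have hsub : (⋃ s, ⋃ a, bad s a)ᶜ
        ⊆ {ω | ‖M.drQ δ n₀ (fun k s a i => X k s a i ω) k₀ - M.qStar δ‖ ≤ ε} := fun ω hω => by
      simp only [Set.mem_compl_iff, Set.mem_iUnion, not_exists] at hω
      refine norm_sub_le_of_forall hε.le fun s a => ?_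
      have h := M.abs_drQ_sub_le hδ.le hn (fun k s a i => X k s a i ω) (q := M.qStar δ)
        (fun s a => by rw [abs_of_nonneg (hq s a).1]; exact (hq s a).2)
        (fun k hk s a => hbad s a ω (hω s a) k hk) s a
      refine h.trans ?_
      rw [show 2 * (2 * l) = 4 * l by ring]
      exact herr
    have hunion : P.real (⋃ s, ⋃ a, bad s a) ≤ η := by
      refine le_trans ?_ (M.union_bound_le hη0 hη1 hkpos)
      refine (measureReal_iUnion_fintype_le _).trans ?_
      rw [← nsmul_eq_mul, ← Finset.card_univ, ← Finset.sum_const]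
      refine Finset.sum_le_sum fun s _ => (measureReal_iUnion_fintype_le _).trans ?_
      rw [← nsmul_eq_mul, ← Finset.card_univ, ← Finset.sum_const]
      exact Finset.sum_le_sum fun a _ => hbadP s a
    have htot := measureReal_union_le (μ := P) (⋃ s, ⋃ a, bad s a) (⋃ s, ⋃ a, bad s a)ᶜ
    rw [Set.union_compl_self, probReal_univ] at htot
    linarith [measureReal_mono (μ := P) hsub]
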